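/- A weighted graph $(E,w)$ is a directed graph $E=(E^0,E^1,s,r)$ with a map $w:E^1\to\{1,2,\dots\}$; all weighted graphs are assumed to have at least one vertex and to be row-finite, i.e. each vertex emits only finitely many edges. For $v\in E^0$ put $w(v)=\max\{w(e)\mid s(e)=v\}$, with $\max\emptyset=0$. Let $K$ be a field. The weighted Leavitt path algebra $L_K(E,w)$ is the associative (not necessarily unital) $K$-algebra generated by the vertices $v\in E^0$ and by elements $e_i,e_i^*$ ($e\in E^1$, $1\le i\le w(e)$), subject to the relations - $uv=\delta_{uv}u$ for $u,v\in E^0$; - $s(e)e_i=e_i=e_ir(e)$ and $r(e)e_i^*=e_i^*=e_i^*s(e)$ for $e\in E^1$, $1\le i\le w(e)$; - $\sum_{e\in s^{-1}(v)}e_ie_j^*=\delta_{ij}v$ for $v\in E^0$, $1\le i,j\le w(v)$; - $\sum_{1\le i\le w(v)}e_i^*f_i=\delta_{ef}r(e)$ for $v\in E^0$, $e,f\in s^{-1}(v)$, where $e_i$ and $e_i^*$ are read as $0$ for $i>w(e)$. Its standard grading is given by $\deg v=0$, $\deg e_i=\epsilon_i$, $\deg e_i^*=-\epsilon_i$, where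 $\epsilon_i$ is the $i$-th unit vector of $\mathbb Z^n$, $n$ being the maximal weight of an edge (of $\mathbb Z^{(\mathbb N)}$ if the weights are unbounded). $L_K(E,w)$ is called locally finite if all its homogeneous components are finite-dimensional over $K$. An edge $e$ is weighted if $w(e)>1$; a weighted edge $e$ is of type A if it is the only edge emitted by $s(e)$, and of type B otherwise. $E^1_w$ denotes the set of weighted edges and $E^1_{w,B}$ the set of weighted edges of type B. A sink is a vertex that emits no edge. **Proposition 5.2.** Suppose that $L_K(E,w)$ is locally finite. Then there is a weighted graph $(\tilde E,\tilde w)$ with $\tilde E^0=E^0$ such that 1. $\tilde E^1_w=\tilde E^1_{w,B}=E^1_{w,B}$, where each edge in this set has the same source, the same range and the same weight in $(\tilde E,\tilde w)$ as in $(E,w)$; 2. the range in $(\tilde E,\tilde w)$ of every edge in $\tilde E^1_w$ is a sink of $(\tilde E,\tilde w)$; 3. $L_K(\tilde E,\tilde w)\cong L_K(E,w)$ as $K$-algebras; 4. $L_K(\tilde E,\tilde w)$ is locally finite. -/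

import Mathlib

universe u v k

/-! ### Associative, not necessarily unital, algebras given by generators and relations -/

section Presentations

/-- The two-sided algebra ideal of `A` generated by `S`: the smallest `K`-subspace of `A` that
contains `S` and is closed under multiplication by elements of `A` on either side. -/
def algIdeal (K : Type u) {A : Type v} [CommRing K] [NonUnitalRing A] [Module K A]
    (S : Set A) : Submodule K A :=
  sInf {I : Submodule K A | S ⊆ (I : Set A) ∧ ∀ a : A, ∀ x ∈ I, a * x ∈ I ∧ x * a ∈ I}

theorem subset_algIdeal (K : Type u) {A : Type v} [CommRing K] [NonUnitalRing A] [Module K A]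
    (S : Set A) : S ⊆ (algIdeal K S : Set A) := by
  intro x hx
  refine Submodule.mem_sInf.2 ?_
  intro I hI
  exact hI.1 hx

theorem mul_mem_algIdeal (K : Type u) {A : Type v} [CommRing K] [NonUnitalRing A] [Module K A]
    (S : Set A) (a : A) {x : A} (hx : x ∈ algIdeal K S) :
    a * x ∈ algIdeal K S ∧ x * a ∈ algIdeal K S := by
  constructor <;>
  · refine Submodule.mem_sInf.2 ?_
    intro I hI
    have h := hI.2 a x (Submodule.mem_sInf.1 hx I hI)
    first
      | exact h.1
      | exact h.2

/-- The quotient algebra of `A` by the two-sided ideal generated by `S`. -/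
def QuotAlg (K : Type u) {A : Type v} [CommRing K] [NonUnitalRing A] [Module K A]
    (S : Set A) : Type v :=
  A ⧸ algIdeal K S

namespace QuotAlg

variable {K : Type u} {A : Type v} [CommRing K] [NonUnitalRing A] [Module K A] {S : Set A}

instance : AddCommGroup (QuotAlg K S) := inferInstanceAs (AddCommGroup (A ⧸ algIdeal K S))

instance : Module K (QuotAlg K S) := inferInstanceAs (Module K (A ⧸ algIdeal K S))

/-- The canonical projection, as a linear map. -/
def mk (K : Type u) {A : Type v} [CommRing K] [NonUnitalRing A] [Module K A] (S : Set A) :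
    A →ₗ[K] QuotAlg K S :=
  (algIdeal K S).mkQ

theorem mk_surjective : Function.Surjective (mk K S) :=
  Submodule.mkQ_surjective _

theorem mk_eq_iff {a b : A} : mk K S a = mk K S b ↔ a - b ∈ algIdeal K S :=
  Submodule.Quotient.eq _

theorem mk_mul_congr {a a' b b' : A} (ha : mk K S a = mk K S a') (hb : mk K S b = mk K S b') :
    mk K S (a * b) = mk K S (a' * b') := by
  rw [mk_eq_iff] at ha hb ⊢
  have h : a * b - a' * b' = (a - a') * b + a' * (b - b') := by
    rw [sub_mul, mul_sub]
    abel
  rw [h]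
  exact add_mem (mul_mem_algIdeal K S b ha).2 (mul_mem_algIdeal K S a' hb).1

instance : Mul (QuotAlg K S) where
  mul := Quotient.map₂ (· * ·) (by
    intro a a' ha b b' hb
    exact Quotient.exact
      (mk_mul_congr (K := K) (S := S) (Quotient.sound ha) (Quotient.sound hb)))

theorem mk_mul (a b : A) : mk K S (a * b) = mk K S a * mk K S b := rfl

instance : NonUnitalRing (QuotAlg K S) where
  left_distrib := by
    intro x y z
    obtain ⟨a, rfl⟩ := mk_surjective x
    obtain ⟨b, rfl⟩ := mk_surjective y
    obtain ⟨c, rfl⟩ := mk_surjective z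
    simp only [← mk_mul, ← map_add, mul_add]
  right_distrib := by
    intro x y z
    obtain ⟨a, rfl⟩ := mk_surjective x
    obtain ⟨b, rfl⟩ := mk_surjective y
    obtain ⟨c, rfl⟩ := mk_surjective z
    simp only [← mk_mul, ← map_add, add_mul]
  zero_mul := by
    intro x
    obtain ⟨a, rfl⟩ := mk_surjective x
    rw [← map_zero (mk K S), ← mk_mul, zero_mul]
  mul_zero := by
    intro x
    obtain ⟨a, rfl⟩ := mk_surjective x
    rw [← map_zero (mk K S), ← mk_mul, mul_zero]
  mul_assoc := by
    intro x y z
    obtain ⟨a, rfl⟩ := mk_surjective x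
    obtain ⟨b, rfl⟩ := mk_surjective y
    obtain ⟨c, rfl⟩ := mk_surjective z
    simp only [← mk_mul, mul_assoc]

instance [IsScalarTower K A A] : IsScalarTower K (QuotAlg K S) (QuotAlg K S) where
  smul_assoc := by
    intro k x y
    obtain ⟨a, rfl⟩ := mk_surjective x
    obtain ⟨b, rfl⟩ := mk_surjective y
    simp only [smul_eq_mul, ← mk_mul, ← map_smul, smul_mul_assoc]

instance [SMulCommClass K A A] : SMulCommClass K (QuotAlg K S) (QuotAlg K S) where
  smul_comm := by
    intro k x y
    obtain ⟨a, rfl⟩ := mk_surjective x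
    obtain ⟨b, rfl⟩ := mk_surjective y
    simp only [smul_eq_mul, ← mk_mul, ← map_smul, mul_smul_comm]

end QuotAlg

end Presentations

/-! ### Weighted graphs -/

/-- A weighted graph with vertex set `V` and edge set `E`: a directed graph with a map that gives
each edge a positive integral weight. Weighted graphs are row-finite and have a vertex. -/
structure WeightedGraph (V : Type*) (E : Type*) where
  /-- the source map -/
  s : E → V
  /-- the range map -/
  r : E → V
  /-- the weight map -/
  w : E → ℕ
  one_le_w : ∀ e, 1 ≤ w e
  rowFinite : ∀ v, {e | s e = v}.Finite
  nonempty : Nonempty V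

namespace WeightedGraph

variable {V : Type u} {E : Type v} (G : WeightedGraph V E)

/-- The finite set of edges emitted by the vertex `x`. -/
noncomputable def out (x : V) : Finset E := (G.rowFinite x).toFinset

/-- The weight of a vertex: the largest weight of an edge that it emits, `0` for a sink. -/
noncomputable def vw (x : V) : ℕ := (G.out x).sup G.w

/-- A vertex is a sink if it emits no edge. -/
def IsSink (x : V) : Prop := ∀ e, G.s e ≠ x

/-- The set of weighted edges, that is, the edges of weight greater than one. -/
def weightedEdges : Set E := {e | 1 < G.w e}

/-- The set of weighted edges of type A: the weighted edges that are the only edge emitted by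
their source. -/
def typeA : Set E := {e | e ∈ G.weightedEdges ∧ {f | G.s f = G.s e} = {e}}

/-- The set of weighted edges of type B: the weighted edges that are not of type A. -/
def typeB : Set E := {e | e ∈ G.weightedEdges ∧ {f | G.s f = G.s e} ≠ {e}}

/-! ### Weighted Leavitt path algebras -/

/-- The letters: the vertices, the real edges `e_i` and the ghost edges `e_i^*`. The index `i` runs
through `0, …, w(e) - 1` in place of `1, …, w(e)`. -/
inductive Letter : Type (max u v)
  | vertex (x : V) : Letter
  | real (e : E) (i : Fin (G.w e)) : Letter
  | ghost (e : E) (i : Fin (G.w e)) : Letter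

/-- The free associative algebra without unit: its basis is the set of nonempty words. -/
abbrev Free (K : Type k) [Field K] : Type (max u v k) := MonoidAlgebra K (FreeSemigroup G.Letter)

/-- The vertex `x` in the free algebra. -/
noncomputable def fv (K : Type k) [Field K] (x : V) : G.Free K :=
  MonoidAlgebra.single (FreeSemigroup.of (Letter.vertex x)) 1

/-- The real edge `e_i` in the free algebra, zero if `i` is not an index of `e`. -/
noncomputable def fe (K : Type k) [Field K] (e : E) (i : ℕ) : G.Free K :=
  if h : i < G.w e then MonoidAlgebra.single (FreeSemigroup.of (Letter.real e ⟨i, h⟩)) 1 else 0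

/-- The ghost edge `e_i^*` in the free algebra, zero if `i` is not an index of `e`. -/
noncomputable def fg (K : Type k) [Field K] (e : E) (i : ℕ) : G.Free K :=
  if h : i < G.w e then MonoidAlgebra.single (FreeSemigroup.of (Letter.ghost e ⟨i, h⟩)) 1 else 0

open Classical in
/-- The differences of the two sides of the defining relations: those of the path algebra of the
double graph, followed by the two families of relations of the weighted Leavitt path algebra. -/
inductive IsRelator (K : Type k) [Field K] : G.Free K → Prop
  | vertex (x y : V) :
      IsRelator K (G.fv K x * G.fv K y - if x = y then G.fv K x else 0)
  | source_real (e : E) (i : ℕ) (hi : i < G.w e) :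
      IsRelator K (G.fv K (G.s e) * G.fe K e i - G.fe K e i)
  | real_range (e : E) (i : ℕ) (hi : i < G.w e) :
      IsRelator K (G.fe K e i * G.fv K (G.r e) - G.fe K e i)
  | range_ghost (e : E) (i : ℕ) (hi : i < G.w e) :
      IsRelator K (G.fv K (G.r e) * G.fg K e i - G.fg K e i)
  | ghost_source (e : E) (i : ℕ) (hi : i < G.w e) :
      IsRelator K (G.fg K e i * G.fv K (G.s e) - G.fg K e i)
  | real_ghost (x : V) (i j : ℕ) (hi : i < G.vw x) (hj : j < G.vw x) :
      IsRelator K ((∑ e ∈ G.out x, G.fe K e i * G.fg K e j) - if i = j then G.fv K x else 0)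
  | ghost_real (x : V) (e f : E) (he : G.s e = x) (hf : G.s f = x) :
      IsRelator K ((∑ i ∈ Finset.range (G.vw x), G.fg K e i * G.fe K f i)
        - if e = f then G.fv K (G.r e) else 0)

/-- The weighted Leavitt path algebra `L_K(G)`. It has a unit only if `V` is finite. -/
abbrev WLPA (K : Type k) [Field K] : Type (max u v k) :=
  QuotAlg K {a : G.Free K | G.IsRelator K a}

/-- The degrees of the letters: `0` for a vertex, the `i`-th unit vector for `e_i` and its
negative for `e_i^*`. If `n` is the maximal weight, then only the first `n` coordinates occur, and
the group `ℕ →₀ ℤ` of degrees can be replaced by its subgroup `ℤ^n`. -/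
noncomputable def letterDegree : G.Letter → (ℕ →₀ ℤ)
  | .vertex _ => 0
  | .real _ i => Finsupp.single (i : ℕ) 1
  | .ghost _ i => -Finsupp.single (i : ℕ) 1

/-- The degree of a word is the sum of the degrees of its letters. -/
noncomputable def degree (p : FreeSemigroup G.Letter) : ℕ →₀ ℤ :=
  (FreeSemigroup.lift (fun x => Multiplicative.ofAdd (G.letterDegree x)) p).toAdd

/-- The homogeneous component of degree `g` of `L_K(G)` in the standard grading: the subspace
spanned by the images of the words of degree `g`. -/
noncomputable def component (K : Type k) [Field K] (g : ℕ →₀ ℤ) : Submodule K (G.WLPA K) :=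
  Submodule.span K {a | ∃ p : FreeSemigroup G.Letter, G.degree p = g ∧
    a = QuotAlg.mk K {b : G.Free K | G.IsRelator K b} (MonoidAlgebra.single p 1)}

/-- `L_K(G)` is locally finite: each homogeneous component of the standard grading is
finite-dimensional. -/
def LocallyFinite (K : Type k) [Field K] : Prop :=
  ∀ g : ℕ →₀ ℤ, FiniteDimensional K (G.component K g)

end WeightedGraph

/-!
The proof compares two kinds of words in the double graph. In comments that write `e_1` or `e_2` the
indices start from `1`; in the code they start from `0`.

*Lower bounds.* Choose at each nonsink a special edge of maximal weight. A path in the double graph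
is normal if it contains neither `e_i e_j^*` with `e` special nor `e_1^* f_1`. Every reducible pair
reduces in one step to words that are already normal, so the algebra acts on the space with basis
the normal words (`fockFamily`), and the normal words are linearly independent
(`linearIndependent_word`). Hence a locally finite algebra has only finitely many normal words of
each degree (`LocallyFinite.finite_isNormal`). Exhibiting powers of normal words of degree zero, one
concludes that there are finitely many vertices, that a vertex emits at most one weighted edge, that
a vertex reachable from the range of a weighted edge emits at most one edge
(`LocallyFinite.eq_of_inTail`), and that the edges that are weighted or start at such a vertex
have distinct ranges (`LocallyFinite.range_injOn`).

*The new graph.* Let `R` consist of those last edges that are not weighted of type B. Each `h ∈ R`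
is the only edge at its source, so the relations for `h` say that `h_1^*, …, h_{w(h)}^*` satisfy the
relations of `w(h)` unweighted edges from `r(h)` to `s(h)`. By the facts above, nothing else is
emitted from `r(h)` once `R` has been reversed. Replacing each `h ∈ R` by these edges therefore does
not change the algebra (`IsReversible.bijective_lift`), and in the new graph the weighted edges are
those of type B, with sinks as ranges.

*Upper bounds.* The isomorphism changes the grading, so that local finiteness of the new algebra
needs an argument. Call the unweighted edges of the new graph and the `e_i^*` with `i ≠ 1`, `e` of
type B, positive, and the edges `e_1` terminal. The words `p q^*`, for paths `p`, `q` of positive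
arrows with at most a terminal arrow at the end, span (`LocallyFinite.val_mul_mem_fwdSpan`). A cycle
`c` of positive arrows has no exit `d`, since `c^n d d^* (c^*)^n` would be infinitely many normal
words of degree zero for the original grading (`LocallyFinite.eq_of_recurrent`). Thus
`a a^* = s(a)` for the arrows `a` of a cycle, all of which have the same nonzero degree. After
cancelling such factors, one of `p` and `q` does not meet a cycle; its length is at most about the
number of vertices, and the length of the other is bounded in terms of the degree
(`LocallyFinite.length_le`). So each component of the new algebra is finite-dimensional.
-/

/-! ### The universal property -/

namespace WeightedGraph

variable {V : Type u} {E : Type v} (G : WeightedGraph V E) (K : Type k) [Field K]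

theorem mem_out {x : V} {e : E} : e ∈ G.out x ↔ G.s e = x := by
  simp [out]

theorem w_le_vw (e : E) : G.w e ≤ G.vw (G.s e) :=
  Finset.le_sup (f := G.w) (G.mem_out.2 rfl)

theorem vw_eq_of_forall_le {e : E} (h : ∀ f, G.s f = G.s e → G.w f ≤ G.w e) :
    G.vw (G.s e) = G.w e :=
  le_antisymm (Finset.sup_le fun f hf => h f (G.mem_out.1 hf)) (G.w_le_vw e)

theorem w_pos (e : E) : 0 < G.w e := G.one_le_w e

/-- The image of the vertex `x` in the weighted Leavitt path algebra. -/
noncomputable def vtx (x : V) : G.WLPA K := QuotAlg.mk K _ (G.fv K x)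

/-- The image of the real edge `e_i` in the weighted Leavitt path algebra, zero if `i` is not an
index of `e`. -/
noncomputable def re (e : E) (i : ℕ) : G.WLPA K := QuotAlg.mk K _ (G.fe K e i)

/-- The image of the ghost edge `e_i^*` in the weighted Leavitt path algebra, zero if `i` is not an
index of `e`. -/
noncomputable def gh (e : E) (i : ℕ) : G.WLPA K := QuotAlg.mk K _ (G.fg K e i)

open Classical in
/-- A family of elements of a `K`-algebra that satisfies the defining relations of the weighted
Leavitt path algebra of `G`. -/
structure LeavittFamily (A : Type*) [NonUnitalRing A] where
  /-- the images of the vertices -/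
  vtx : V → A
  /-- the images of the real edges -/
  re : E → ℕ → A
  /-- the images of the ghost edges -/
  gh : E → ℕ → A
  re_zero : ∀ e i, G.w e ≤ i → re e i = 0
  gh_zero : ∀ e i, G.w e ≤ i → gh e i = 0
  vtx_mul_vtx : ∀ x y, vtx x * vtx y = if x = y then vtx x else 0
  source_real : ∀ e i, i < G.w e → vtx (G.s e) * re e i = re e i
  real_range : ∀ e i, i < G.w e → re e i * vtx (G.r e) = re e i
  range_ghost : ∀ e i, i < G.w e → vtx (G.r e) * gh e i = gh e i
  ghost_source : ∀ e i, i < G.w e → gh e i * vtx (G.s e) = gh e i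
  real_ghost : ∀ x i j, i < G.vw x → j < G.vw x →
    ∑ e ∈ G.out x, re e i * gh e j = if i = j then vtx x else 0
  ghost_real : ∀ e f, G.s e = G.s f →
    ∑ i ∈ Finset.range (G.vw (G.s e)), gh e i * re f i = if e = f then vtx (G.r e) else 0

section Lift

variable {G K}
variable {A : Type*} [NonUnitalRing A] [Module K A] [IsScalarTower K A A] [SMulCommClass K A A]

namespace LeavittFamily

variable (F : G.LeavittFamily A)

/-- The value of a letter under a Leavitt family. -/
def letter : G.Letter → A
  | .vertex x => F.vtx x
  | .real e i => F.re e i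
  | .ghost e i => F.gh e i

/-- The homomorphism from the free algebra that belongs to a Leavitt family. -/
noncomputable def freeLift : G.Free K →ₙₐ[K] A :=
  MonoidAlgebra.liftMagma K (FreeSemigroup.lift F.letter)

theorem freeLift_single (p : FreeSemigroup G.Letter) :
    F.freeLift (K := K) (MonoidAlgebra.single p 1) = FreeSemigroup.lift F.letter p := by
  simp [freeLift, MonoidAlgebra.liftMagma_apply_apply]

theorem freeLift_fv (x : V) : F.freeLift (G.fv K x) = F.vtx x := by
  rw [fv, freeLift_single]; rfl

theorem freeLift_fe (e : E) (i : ℕ) : F.freeLift (G.fe K e i) = F.re e i := by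
  unfold fe
  split_ifs with h
  · rw [freeLift_single]; rfl
  · rw [map_zero, F.re_zero e i (not_lt.1 h)]

theorem freeLift_fg (e : E) (i : ℕ) : F.freeLift (G.fg K e i) = F.gh e i := by
  unfold fg
  split_ifs with h
  · rw [freeLift_single]; rfl
  · rw [map_zero, F.gh_zero e i (not_lt.1 h)]

theorem freeLift_relator {a : G.Free K} (ha : G.IsRelator K a) : F.freeLift a = 0 := by
  classical
  cases ha with
  | vertex x y =>
    rw [map_sub, map_mul, freeLift_fv, freeLift_fv, F.vtx_mul_vtx, sub_eq_zero]
    split_ifs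
    · rw [freeLift_fv]
    · rw [map_zero]
  | source_real e i hi =>
    rw [map_sub, map_mul, freeLift_fv, freeLift_fe, F.source_real e i hi, sub_self]
  | real_range e i hi =>
    rw [map_sub, map_mul, freeLift_fv, freeLift_fe, F.real_range e i hi, sub_self]
  | range_ghost e i hi =>
    rw [map_sub, map_mul, freeLift_fv, freeLift_fg, F.range_ghost e i hi, sub_self]
  | ghost_source e i hi =>
    rw [map_sub, map_mul, freeLift_fv, freeLift_fg, F.ghost_source e i hi, sub_self]
  | real_ghost x i j hi hj =>
    rw [map_sub, map_sum, sub_eq_zero]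
    simp only [map_mul, freeLift_fe, freeLift_fg]
    rw [F.real_ghost x i j hi hj]
    split_ifs
    · rw [freeLift_fv]
    · rw [map_zero]
  | ghost_real x e f he hf =>
    subst he
    rw [map_sub, map_sum, sub_eq_zero]
    simp only [map_mul, freeLift_fe, freeLift_fg]
    rw [F.ghost_real e f hf.symm]
    split_ifs
    · rw [freeLift_fv]
    · rw [map_zero]

theorem algIdeal_le_ker :
    algIdeal K {a : G.Free K | G.IsRelator K a} ≤
      LinearMap.ker (F.freeLift (K := K) : G.Free K →ₗ[K] A) := by
  refine sInf_le ⟨fun a ha => F.freeLift_relator ha, fun a x hx => ?_⟩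
  have hx' : F.freeLift x = 0 := hx
  constructor
  · change F.freeLift (a * x) = 0
    rw [map_mul, hx', mul_zero]
  · change F.freeLift (x * a) = 0
    rw [map_mul, hx', zero_mul]

/-- The universal property of the weighted Leavitt path algebra. -/
noncomputable def lift : G.WLPA K →ₙₐ[K] A where
  toFun := Submodule.liftQ _ (F.freeLift (K := K) : G.Free K →ₗ[K] A) F.algIdeal_le_ker
  map_smul' c x := map_smul (Submodule.liftQ _ _ F.algIdeal_le_ker) c x
  map_zero' := map_zero (Submodule.liftQ _ _ F.algIdeal_le_ker)
  map_add' x y := map_add (Submodule.liftQ _ _ F.algIdeal_le_ker) x y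
  map_mul' x y := by
    obtain ⟨a, rfl⟩ := QuotAlg.mk_surjective x
    obtain ⟨b, rfl⟩ := QuotAlg.mk_surjective y
    exact map_mul F.freeLift a b

@[simp] theorem lift_vtx (x : V) : F.lift (G.vtx K x) = F.vtx x := F.freeLift_fv x

@[simp] theorem lift_re (e : E) (i : ℕ) : F.lift (G.re K e i) = F.re e i := F.freeLift_fe e i

@[simp] theorem lift_gh (e : E) (i : ℕ) : F.lift (G.gh K e i) = F.gh e i := F.freeLift_fg e i

end LeavittFamily

end Lift

theorem re_zero (e : E) (i : ℕ) (h : G.w e ≤ i) : G.re K e i = 0 := by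
  rw [re, fe, dif_neg (not_lt.2 h), map_zero]

theorem gh_zero (e : E) (i : ℕ) (h : G.w e ≤ i) : G.gh K e i = 0 := by
  rw [gh, fg, dif_neg (not_lt.2 h), map_zero]

theorem mk_eq_of_isRelator {a b : G.Free K} (h : G.IsRelator K (a - b)) :
    QuotAlg.mk K {c : G.Free K | G.IsRelator K c} a = QuotAlg.mk K _ b :=
  QuotAlg.mk_eq_iff.2 (subset_algIdeal K _ h)

open Classical in
theorem vtx_mul_vtx (x y : V) :
    G.vtx K x * G.vtx K y = if x = y then G.vtx K x else 0 := by
  have h := G.mk_eq_of_isRelator K (.vertex x y)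
  rw [QuotAlg.mk_mul] at h
  refine h.trans ?_
  split_ifs
  · rfl
  · rw [map_zero]

theorem source_mul_re (e : E) (i : ℕ) : G.vtx K (G.s e) * G.re K e i = G.re K e i := by
  by_cases hi : i < G.w e
  · exact G.mk_eq_of_isRelator K (.source_real e i hi)
  · rw [G.re_zero K e i (not_lt.1 hi), mul_zero]

theorem re_mul_range (e : E) (i : ℕ) : G.re K e i * G.vtx K (G.r e) = G.re K e i := by
  by_cases hi : i < G.w e
  · exact G.mk_eq_of_isRelator K (.real_range e i hi)
  · rw [G.re_zero K e i (not_lt.1 hi), zero_mul]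

theorem range_mul_gh (e : E) (i : ℕ) : G.vtx K (G.r e) * G.gh K e i = G.gh K e i := by
  by_cases hi : i < G.w e
  · exact G.mk_eq_of_isRelator K (.range_ghost e i hi)
  · rw [G.gh_zero K e i (not_lt.1 hi), mul_zero]

theorem gh_mul_source (e : E) (i : ℕ) : G.gh K e i * G.vtx K (G.s e) = G.gh K e i := by
  by_cases hi : i < G.w e
  · exact G.mk_eq_of_isRelator K (.ghost_source e i hi)
  · rw [G.gh_zero K e i (not_lt.1 hi), zero_mul]

open Classical in
theorem sum_re_mul_gh (x : V) (i j : ℕ) (hi : i < G.vw x) (hj : j < G.vw x) :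
    ∑ e ∈ G.out x, G.re K e i * G.gh K e j = if i = j then G.vtx K x else 0 := by
  have h := G.mk_eq_of_isRelator K (.real_ghost x i j hi hj)
  rw [map_sum] at h
  refine h.trans ?_
  split_ifs
  · rfl
  · rw [map_zero]

open Classical in
theorem sum_gh_mul_re (e f : E) (h : G.s e = G.s f) :
    ∑ i ∈ Finset.range (G.vw (G.s e)), G.gh K e i * G.re K f i =
      if e = f then G.vtx K (G.r e) else 0 := by
  have h := G.mk_eq_of_isRelator K (.ghost_real (G.s e) e f rfl h.symm)
  rw [map_sum] at h
  refine h.trans ?_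
  split_ifs
  · rfl
  · rw [map_zero]

variable {G K} in
/-- The image of a letter in the weighted Leavitt path algebra. -/
noncomputable def letterVal : G.Letter → G.WLPA K
  | .vertex x => G.vtx K x
  | .real e i => G.re K e i
  | .ghost e i => G.gh K e i

theorem mk_of (a : G.Letter) :
    QuotAlg.mk K {b : G.Free K | G.IsRelator K b} (MonoidAlgebra.single (FreeSemigroup.of a) 1) =
      letterVal a := by
  cases a with
  | vertex x => rfl
  | real e i => simp [letterVal, re, fe]
  | ghost e i => simp [letterVal, gh, fg]

theorem mk_of_mul (a : G.Letter) (p : FreeSemigroup G.Letter) :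
    QuotAlg.mk K {b : G.Free K | G.IsRelator K b}
        (MonoidAlgebra.single (FreeSemigroup.of a * p) 1) =
      letterVal a * QuotAlg.mk K _ (MonoidAlgebra.single p 1) := by
  rw [← mk_of, ← QuotAlg.mk_mul, MonoidAlgebra.single_mul_single, one_mul]

variable {K} in
/-- A homomorphism from the weighted Leavitt path algebra is determined by the images of the
vertices and of the real and ghost edges. -/
theorem algHom_ext {A : Type*} [NonUnitalRing A] [Module K A] {φ ψ : G.WLPA K →ₙₐ[K] A}
    (hv : ∀ x, φ (G.vtx K x) = ψ (G.vtx K x))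
    (hr : ∀ e i, φ (G.re K e i) = ψ (G.re K e i))
    (hg : ∀ e i, φ (G.gh K e i) = ψ (G.gh K e i)) : φ = ψ := by
  have hl : ∀ a : G.Letter, φ (letterVal a) = ψ (letterVal a) := by
    rintro (x | ⟨e, i⟩ | ⟨e, i⟩)
    · exact hv x
    · exact hr e i
    · exact hg e i
  ext x
  obtain ⟨a, rfl⟩ := QuotAlg.mk_surjective x
  induction a using MonoidAlgebra.induction_linear with
  | zero => simp only [map_zero]
  | add f g hf hg => simp only [map_add, hf, hg]
  | single p c =>
    have h1 : (MonoidAlgebra.single p c : G.Free K) = c • MonoidAlgebra.single p 1 := by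
      rw [MonoidAlgebra.smul_single, smul_eq_mul, mul_one]
    rw [h1, map_smul, map_smul, map_smul]
    congr 1
    clear h1
    induction p using FreeSemigroup.recOnMul with
    | ih1 a => rw [mk_of, hl]
    | ih2 a p _ ih => rw [mk_of_mul, map_mul, map_mul, hl, ih]

end WeightedGraph

/-! ### Normal words and the Fock representation -/

namespace WeightedGraph

/-- An arrow of the double graph: a real edge `e_i` or a ghost edge `e_i^*`. The index is an
arbitrary natural number; whether it is an index of `e` is recorded by `WeightedGraph.Valid`. -/
inductive Arrow (E : Type v) : Type v
  | real (e : E) (i : ℕ) : Arrow E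
  | ghost (e : E) (i : ℕ) : Arrow E

variable {V : Type u} {E : Type v} (G : WeightedGraph V E) (K : Type k) [Field K]

/-- The source of an arrow of the double graph. -/
def src : Arrow E → V
  | .real e _ => G.s e
  | .ghost e _ => G.r e

/-- The range of an arrow of the double graph. -/
def tgt : Arrow E → V
  | .real e _ => G.r e
  | .ghost e _ => G.s e

/-- The index of the arrow is an index of its edge. -/
def Valid : Arrow E → Prop
  | .real e i => i < G.w e
  | .ghost e i => i < G.w e

/-- A choice of one edge of maximal weight at each vertex that emits an edge. -/
structure IsSpecial (sp : Set E) : Prop where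
  exists_mem : ∀ e, ∃ f ∈ sp, G.s f = G.s e
  eq_of_mem : ∀ e ∈ sp, ∀ f ∈ sp, G.s e = G.s f → e = f
  w_le : ∀ e ∈ sp, ∀ f, G.s f = G.s e → G.w f ≤ G.w e

/-- Two consecutive arrows of the double graph form a normal word: they are composable, and they
are neither of the form `e_i e_j^*` with `e` special nor of the form `e_1^* f_1` (in the
numbering of `WeightedGraph.Letter`, the first index is `0`). -/
def Fits (sp : Set E) : Arrow E → Arrow E → Prop
  | .real e _, .real f _ => G.r e = G.s f
  | .ghost e _, .ghost f _ => G.s e = G.r f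
  | .real e _, .ghost f _ => G.r e = G.r f ∧ ¬(e = f ∧ e ∈ sp)
  | .ghost e i, .real f j => G.s e = G.s f ∧ ¬(i = 0 ∧ j = 0)

/-- The source of the path that consists of the arrows `l` and ends at `y`. -/
def start : List (Arrow E) → V → V
  | [], y => y
  | a :: _, _ => G.src a

/-- The arrow `a` can be put in front of the normal word `l` that ends at `y`. -/
def FitsList (sp : Set E) (a : Arrow E) : List (Arrow E) → V → Prop
  | [], y => G.tgt a = y
  | b :: _, _ => G.Fits sp a b

/-- `l` is the list of arrows of a normal word that ends at the vertex `y`. -/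
def IsNormal (sp : Set E) : List (Arrow E) → V → Prop
  | [], _ => True
  | a :: l, y => G.Valid a ∧ G.FitsList sp a l y ∧ IsNormal sp l y

/-- The vector space with the normal words as a basis. -/
abbrev Fock (sp : Set E) : Type (max u v k) :=
  {p : List (Arrow E) × V // G.IsNormal sp p.1 p.2} →₀ K

variable {sp : Set E}

open Classical in
/-- The basis vector of a normal word; zero if the word is not normal. -/
noncomputable def bas (sp : Set E) (l : List (Arrow E)) (y : V) : G.Fock K sp :=
  if h : G.IsNormal sp l y then Finsupp.single ⟨(l, y), h⟩ 1 else 0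

variable {G K} in
theorem bas_eq_zero {l : List (Arrow E)} {y : V} (h : ¬G.IsNormal sp l y) :
    G.bas K sp l y = 0 := dif_neg h

variable {G K} in
theorem bas_cons_eq_zero {a : Arrow E} {l : List (Arrow E)} {y : V} (h : ¬G.Valid a) :
    G.bas K sp (a :: l) y = 0 := bas_eq_zero fun hn => h hn.1

variable {G K} in
theorem bas_cons_cons_eq_zero {a b : Arrow E} {l : List (Arrow E)} {y : V} (h : ¬G.Valid b) :
    G.bas K sp (a :: b :: l) y = 0 := bas_eq_zero fun hn => h hn.2.2.1

variable {G K} in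
theorem Fits.tgt_eq {a b : Arrow E} (h : G.Fits sp a b) : G.tgt a = G.src b := by
  cases a <;> cases b <;> first | exact h | exact h.1

variable {G K} in
theorem FitsList.tgt_eq {a : Arrow E} {l : List (Arrow E)} {y : V} (h : G.FitsList sp a l y) :
    G.tgt a = G.start l y := by
  cases l with
  | nil => exact h
  | cons b l => exact Fits.tgt_eq (G := G) h

open Classical in
/-- The action of the vertex `x` on a normal word. -/
noncomputable def actVtx (sp : Set E) (x : V) (l : List (Arrow E)) (y : V) : G.Fock K sp :=
  if G.start l y = x then G.bas K sp l y else 0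

open Classical in
/-- The action of the real edge `e_i` on a normal word: concatenation, followed by the reduction
of `e_i e_j^*` for special `e`. -/
noncomputable def actRe (sp : Set E) (e : E) (i : ℕ) : List (Arrow E) → V → G.Fock K sp
  | .ghost f j :: l, y =>
    if e = f ∧ e ∈ sp ∧ i < G.w e then
      (if i = j then G.bas K sp l y else 0) -
        ∑ g ∈ (G.out (G.s e)).erase e, G.bas K sp (.real g i :: .ghost g j :: l) y
    else G.bas K sp (.real e i :: .ghost f j :: l) y
  | l, y => G.bas K sp (.real e i :: l) y

open Classical in
/-- The action of the ghost edge `e_i^*` on a normal word: concatenation, followed by the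
reduction of `e_1^* f_1`. -/
noncomputable def actGh (sp : Set E) (e : E) (i : ℕ) : List (Arrow E) → V → G.Fock K sp
  | .real f j :: l, y =>
    if G.s e = G.s f ∧ i = 0 ∧ j = 0 then
      (if e = f then G.bas K sp l y else 0) -
        ∑ m ∈ Finset.Ico 1 (G.vw (G.s e)), G.bas K sp (.ghost e m :: .real f m :: l) y
    else G.bas K sp (.ghost e i :: .real f j :: l) y
  | l, y => G.bas K sp (.ghost e i :: l) y

/-- The linear extension of an action on normal words. -/
noncomputable def extend (sp : Set E) (f : List (Arrow E) → V → G.Fock K sp) :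
    Module.End K (G.Fock K sp) :=
  Finsupp.linearCombination K fun p => f p.1.1 p.1.2

variable {G K}

theorem extend_bas {f : List (Arrow E) → V → G.Fock K sp} {l : List (Arrow E)} {y : V}
    (h : G.IsNormal sp l y) : G.extend K sp f (G.bas K sp l y) = f l y := by
  rw [bas, dif_pos h, extend, Finsupp.linearCombination_single, one_smul]

theorem extend_bas' {f : List (Arrow E) → V → G.Fock K sp} {l : List (Arrow E)} {y : V}
    (hf : ¬G.IsNormal sp l y → f l y = 0) : G.extend K sp f (G.bas K sp l y) = f l y := by
  by_cases h : G.IsNormal sp l y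
  · exact extend_bas h
  · rw [bas_eq_zero h, map_zero, hf h]

theorem end_ext {φ ψ : Module.End K (G.Fock K sp)}
    (h : ∀ l y, G.IsNormal sp l y → φ (G.bas K sp l y) = ψ (G.bas K sp l y)) : φ = ψ := by
  refine Finsupp.lhom_ext' fun ⟨⟨l, y⟩, hp⟩ => LinearMap.ext_ring ?_
  have := h l y hp
  rw [bas, dif_pos hp] at this
  exact this

theorem actVtx_of_start {x : V} {l : List (Arrow E)} {y : V} (h : G.start l y = x) :
    G.actVtx K sp x l y = G.bas K sp l y := if_pos h

theorem actVtx_of_ne {x : V} {l : List (Arrow E)} {y : V} (h : G.start l y ≠ x) :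
    G.actVtx K sp x l y = 0 := if_neg h

theorem vtx_bas {x : V} {l : List (Arrow E)} {y : V} (h : G.start l y = x) :
    G.extend K sp (G.actVtx K sp x) (G.bas K sp l y) = G.bas K sp l y := by
  rw [extend_bas' (fun hn => by rw [actVtx_of_start h, bas_eq_zero hn]), actVtx_of_start h]

theorem vtx_bas_of_ne {x : V} {l : List (Arrow E)} {y : V} (h : G.start l y ≠ x) :
    G.extend K sp (G.actVtx K sp x) (G.bas K sp l y) = 0 := by
  rw [extend_bas' (fun hn => by rw [actVtx_of_ne h]), actVtx_of_ne h]

/-- The word `l` does not start with an arrow that reduces with `e_i` in front of it. -/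
def ReIrr (sp : Set E) (e : E) (l : List (Arrow E)) : Prop :=
  e ∈ sp → ∀ j l', l ≠ .ghost e j :: l'

/-- The word `l` does not start with an arrow that reduces with `e_i^*` in front of it. -/
def GhIrr (G : WeightedGraph V E) (e : E) (i : ℕ) (l : List (Arrow E)) : Prop :=
  i = 0 → ∀ f l', G.s e = G.s f → l ≠ .real f 0 :: l'

theorem actRe_of_irr {e : E} {i : ℕ} {l : List (Arrow E)} {y : V} (h : ReIrr sp e l) :
    G.actRe K sp e i l y = G.bas K sp (.real e i :: l) y := by
  match l with
  | [] => rfl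
  | .real f j :: l => rfl
  | .ghost f j :: l =>
    rw [actRe, if_neg]
    rintro ⟨rfl, h1, -⟩
    exact h h1 j l rfl

theorem actGh_of_irr {e : E} {i : ℕ} {l : List (Arrow E)} {y : V} (h : G.GhIrr e i l) :
    G.actGh K sp e i l y = G.bas K sp (.ghost e i :: l) y := by
  match l with
  | [] => rfl
  | .ghost f j :: l => rfl
  | .real f j :: l =>
    rw [actGh, if_neg]
    rintro ⟨h1, rfl, rfl⟩
    exact h rfl f l h1 rfl

theorem actRe_eq_zero_of_le {e : E} {i : ℕ} (hi : G.w e ≤ i) (l : List (Arrow E)) (y : V) :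
    G.actRe K sp e i l y = 0 := by
  have h0 : ∀ l, G.bas K sp (.real e i :: l) y = 0 :=
    fun l => bas_eq_zero fun h => absurd h.1 (not_lt.2 hi)
  match l with
  | [] => exact h0 _
  | .real f j :: l => exact h0 _
  | .ghost f j :: l =>
    rw [actRe, if_neg (fun h => absurd h.2.2 (not_lt.2 hi)), h0]

theorem actGh_eq_zero_of_le {e : E} {i : ℕ} (hi : G.w e ≤ i) (l : List (Arrow E)) (y : V) :
    G.actGh K sp e i l y = 0 := by
  have h0 : ∀ l, G.bas K sp (.ghost e i :: l) y = 0 :=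
    fun l => bas_eq_zero fun h => absurd h.1 (not_lt.2 hi)
  match l with
  | [] => exact h0 _
  | .ghost f j :: l => exact h0 _
  | .real f j :: l =>
    rw [actGh, if_neg, h0]
    rintro ⟨-, rfl, -⟩
    exact absurd (G.w_pos e) (not_lt.2 hi)

theorem reIrr_of_fitsList {e : E} {i : ℕ} {l : List (Arrow E)} {y : V}
    (h : G.FitsList sp (.real e i) l y) : ReIrr sp e l := by
  rintro h1 j l' rfl
  exact h.2 ⟨rfl, h1⟩

theorem ghIrr_of_fitsList {e : E} {i : ℕ} {l : List (Arrow E)} {y : V}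
    (h : G.FitsList sp (.ghost e i) l y) : G.GhIrr e i l := by
  rintro rfl f l' - rfl
  exact h.2 ⟨rfl, rfl⟩

theorem fitsList_re {e : E} {i : ℕ} {l : List (Arrow E)} {y : V} (h : ReIrr sp e l)
    (hs : G.start l y = G.r e) : G.FitsList sp (.real e i) l y := by
  match l with
  | [] => exact hs.symm
  | .real f j :: l => exact hs.symm
  | .ghost f j :: l =>
    refine ⟨hs.symm, ?_⟩
    rintro ⟨rfl, h1⟩
    exact h h1 j l rfl

theorem fitsList_gh {e : E} {i : ℕ} {l : List (Arrow E)} {y : V} (h : G.GhIrr e i l)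
    (hs : G.start l y = G.s e) : G.FitsList sp (.ghost e i) l y := by
  match l with
  | [] => exact hs.symm
  | .ghost f j :: l => exact hs.symm
  | .real f j :: l =>
    refine ⟨hs.symm, ?_⟩
    rintro ⟨rfl, rfl⟩
    exact h rfl f l hs.symm rfl

theorem actRe_of_start_ne {e : E} {i : ℕ} {l : List (Arrow E)} {y : V}
    (h : G.start l y ≠ G.r e) : G.actRe K sp e i l y = 0 := by
  rw [actRe_of_irr, bas_eq_zero]
  · exact fun hn => h hn.2.1.tgt_eq.symm
  · rintro - j l' rfl
    exact h rfl

theorem actGh_of_start_ne {e : E} {i : ℕ} {l : List (Arrow E)} {y : V}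
    (h : G.start l y ≠ G.s e) : G.actGh K sp e i l y = 0 := by
  rw [actGh_of_irr, bas_eq_zero]
  · exact fun hn => h hn.2.1.tgt_eq.symm
  · rintro - f l' h1 rfl
    exact h h1.symm

theorem vtx_actRe (e : E) (i : ℕ) {l : List (Arrow E)} {y : V} (hl : G.IsNormal sp l y) :
    G.extend K sp (G.actVtx K sp (G.s e)) (G.actRe K sp e i l y) = G.actRe K sp e i l y := by
  classical
  match l with
  | [] => exact vtx_bas rfl
  | .real f j :: l => exact vtx_bas rfl
  | .ghost f j :: l =>
    rw [actRe]
    split_ifs with h1 h2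
    · rw [map_sub, map_sum, vtx_bas]
      · congr 1
        refine Finset.sum_congr rfl fun g hg => vtx_bas ?_
        exact G.mem_out.1 (Finset.mem_of_mem_erase hg)
      · rw [h1.1]
        exact hl.2.1.tgt_eq.symm
    · rw [map_sub, map_sum, map_zero]
      congr 1
      refine Finset.sum_congr rfl fun g hg => vtx_bas ?_
      exact G.mem_out.1 (Finset.mem_of_mem_erase hg)
    · exact vtx_bas rfl

theorem vtx_actGh (e : E) (i : ℕ) {l : List (Arrow E)} {y : V} (hl : G.IsNormal sp l y) :
    G.extend K sp (G.actVtx K sp (G.r e)) (G.actGh K sp e i l y) = G.actGh K sp e i l y := by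
  classical
  match l with
  | [] => exact vtx_bas rfl
  | .ghost f j :: l => exact vtx_bas rfl
  | .real f j :: l =>
    rw [actGh]
    split_ifs with h1 h2
    · rw [map_sub, map_sum, vtx_bas]
      · congr 1
        exact Finset.sum_congr rfl fun m _ => vtx_bas rfl
      · rw [h2]
        exact hl.2.1.tgt_eq.symm
    · rw [map_sub, map_sum, map_zero]
      congr 1
      exact Finset.sum_congr rfl fun m _ => vtx_bas rfl
    · exact vtx_bas rfl

theorem IsSpecial.vw_eq (hsp : G.IsSpecial sp) {e : E} (he : e ∈ sp) :
    G.vw (G.s e) = G.w e := G.vw_eq_of_forall_le (hsp.w_le e he)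

open Classical in
/-- The relation `∑ e_i e_j^* = δ_ij x` on a word `l` that no `e_j^*` reduces with: reducing the
summand of the special edge cancels all other summands. -/
theorem sum_actRe_ghost (hsp : G.IsSpecial sp) {x : V} {i j : ℕ} (hi : i < G.vw x)
    (hj : j < G.vw x) {l : List (Arrow E)} {y : V} (hl : G.IsNormal sp l y)
    (hs : G.start l y = x) (hirr : ∀ e, G.s e = x → G.GhIrr e j l) :
    ∑ e ∈ G.out x, G.extend K sp (G.actRe K sp e i) (G.bas K sp (.ghost e j :: l) y) =
      if i = j then G.bas K sp l y else 0 := by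
  have hne : (G.out x).Nonempty := by
    by_contra h
    rw [Finset.not_nonempty_iff_eq_empty] at h
    simp [vw, h] at hj
  obtain ⟨e₁, he₁⟩ := hne
  obtain ⟨e, he, hes⟩ := hsp.exists_mem e₁
  rw [G.mem_out.1 he₁] at hes
  have hw : G.w e = G.vw x := by rw [← hes, hsp.vw_eq he]
  have hnorm : ∀ f, G.s f = x → j < G.w f → G.IsNormal sp (.ghost f j :: l) y :=
    fun f hf hjf => ⟨hjf, fitsList_gh (hirr f hf) (hs.trans hf.symm), hl⟩
  rw [← Finset.add_sum_erase _ _ (G.mem_out.2 hes), extend_bas (hnorm e hes (hw ▸ hj)), actRe,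
    if_pos ⟨rfl, he, hw ▸ hi⟩, hes]
  rw [sub_add_eq_add_sub, add_sub_assoc, ← Finset.sum_sub_distrib, Finset.sum_eq_zero, add_zero]
  intro f hf
  rw [Finset.mem_erase, mem_out] at hf
  by_cases hjf : j < G.w f
  · rw [extend_bas (hnorm f hf.2 hjf), actRe, if_neg, sub_self]
    rintro ⟨-, h1, -⟩
    exact hf.1 (hsp.eq_of_mem f h1 e he (hf.2.trans hes.symm))
  · rw [bas_cons_eq_zero (G := G) (a := .ghost f j) hjf,
      bas_cons_cons_eq_zero (G := G) (b := .ghost f j) hjf, map_zero, sub_zero]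

open Classical in
/-- The relation `∑ e_i^* f_i = δ_ef r(e)` on a word `l` that no `f_i` reduces with: reducing the
summand of the first index cancels all other summands. -/
theorem sum_actGh_real {e f : E} (hef : G.s e = G.s f) {l : List (Arrow E)} {y : V}
    (hl : G.IsNormal sp l y) (hs : G.start l y = G.r f) (hirr : ReIrr sp f l) :
    ∑ i ∈ Finset.range (G.vw (G.s e)),
        G.extend K sp (G.actGh K sp e i) (G.bas K sp (.real f i :: l) y) =
      if e = f then G.bas K sp l y else 0 := by
  have hnorm : ∀ i, i < G.w f → G.IsNormal sp (.real f i :: l) y :=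
    fun i hif => ⟨hif, fitsList_re hirr hs, hl⟩
  have hpos : 0 < G.vw (G.s e) := (G.w_pos e).trans_le (G.w_le_vw e)
  rw [Finset.range_eq_Ico, Finset.sum_eq_sum_Ico_succ_bot hpos, extend_bas (hnorm 0 (G.w_pos f)),
    actGh, if_pos ⟨hef, rfl, rfl⟩, zero_add]
  rw [sub_add_eq_add_sub, add_sub_assoc, ← Finset.sum_sub_distrib, Finset.sum_eq_zero, add_zero]
  intro i hi
  rw [Finset.mem_Ico] at hi
  by_cases hif : i < G.w f
  · rw [extend_bas (hnorm i hif), actGh, if_neg, sub_self]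
    omega
  · rw [bas_cons_eq_zero (G := G) (a := .real f i) hif,
      bas_cons_cons_eq_zero (G := G) (b := .real f i) hif, map_zero, sub_zero]

open Classical in
/-- The relation `∑ e_i e_j^* = δ_ij x` on all normal words. If `e_j^*` reduces with the word, then
`j = 0` (the first index), the word is `h_0 l`, and the words `e_m^* h_m l` that arise fall under
`sum_actRe_ghost`. -/
theorem sum_actRe_actGh (hsp : G.IsSpecial sp) {x : V} {i j : ℕ} (hi : i < G.vw x)
    (hj : j < G.vw x) {l : List (Arrow E)} {y : V} (hl : G.IsNormal sp l y) :
    ∑ e ∈ G.out x, G.extend K sp (G.actRe K sp e i) (G.actGh K sp e j l y) =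
      if i = j then G.actVtx K sp x l y else 0 := by
  by_cases hs : G.start l y = x
  swap
  · rw [actVtx_of_ne hs, ite_self]
    refine Finset.sum_eq_zero fun e he => ?_
    rw [actGh_of_start_ne, map_zero]
    rwa [G.mem_out.1 he]
  rw [actVtx_of_start hs]
  by_cases hred : j = 0 ∧ ∃ h l', l = .real h 0 :: l'
  swap
  · have hirr : ∀ e, G.s e = x → G.GhIrr e j l :=
      fun e _ hj0 h l' _ hl' => hred ⟨hj0, h, l', hl'⟩
    rw [← sum_actRe_ghost hsp hi hj hl hs hirr]
    refine Finset.sum_congr rfl fun e he => ?_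
    rw [actGh_of_irr (hirr e (G.mem_out.1 he))]
  obtain ⟨rfl, h, l, rfl⟩ := hred
  have hs' : G.s h = x := hs
  have hirr : ReIrr sp h l := reIrr_of_fitsList hl.2.1
  have hstart : G.start l y = G.r h := hl.2.1.tgt_eq.symm
  -- `h_m` does not reduce with `l` for any `m`, because `h_0` does not.
  have hlow : ∀ m ∈ Finset.Ico 1 (G.vw x),
      ∑ e ∈ G.out x, G.extend K sp (G.actRe K sp e i)
        (G.bas K sp (.ghost e m :: .real h m :: l) y) =
      if i = m then G.bas K sp (.real h m :: l) y else 0 := by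
    intro m hm
    rw [Finset.mem_Ico] at hm
    by_cases hmh : m < G.w h
    · refine sum_actRe_ghost hsp hi hm.2 ⟨hmh, fitsList_re hirr hstart, hl.2.2⟩ hs' ?_
      intro e _ hm0
      omega
    · rw [bas_cons_eq_zero (G := G) (a := .real h m) hmh, ite_self]
      refine Finset.sum_eq_zero fun e _ => ?_
      rw [bas_cons_cons_eq_zero (G := G) (b := .real h m) hmh, map_zero]
  have hcalc : ∀ e ∈ G.out x, G.extend K sp (G.actRe K sp e i)
      (G.actGh K sp e 0 (.real h 0 :: l) y) =
      (if e = h then G.bas K sp (.real h i :: l) y else 0) -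
        ∑ m ∈ Finset.Ico 1 (G.vw x), G.extend K sp (G.actRe K sp e i)
          (G.bas K sp (.ghost e m :: .real h m :: l) y) := by
    intro e he
    have he' := G.mem_out.1 he
    rw [actGh, if_pos ⟨he'.trans hs'.symm, rfl, rfl⟩, map_sub, map_sum, he']
    congr 1
    split_ifs with heh
    · rw [extend_bas hl.2.2, heh, actRe_of_irr hirr]
    · rw [map_zero]
  rw [Finset.sum_congr rfl hcalc, Finset.sum_sub_distrib, Finset.sum_ite_eq',
    if_pos (G.mem_out.2 hs'), Finset.sum_comm, Finset.sum_congr rfl hlow, Finset.sum_ite_eq]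
  by_cases hi0 : i = 0
  · subst hi0
    simp
  · rw [if_pos (Finset.mem_Ico.2 ⟨by omega, hi⟩), if_neg hi0, sub_self]

open Classical in
/-- The relation `∑ e_i^* f_i = δ_ef r(e)` on all normal words. If `f_i` reduces with the word, then
`f` is special, the word is `f_j^* l`, and the words `g_i g_j^* l` that arise fall under
`sum_actGh_real`. -/
theorem sum_actGh_actRe (hsp : G.IsSpecial sp) {e f : E} (hef : G.s e = G.s f)
    {l : List (Arrow E)} {y : V} (hl : G.IsNormal sp l y) :
    ∑ i ∈ Finset.range (G.vw (G.s e)), G.extend K sp (G.actGh K sp e i) (G.actRe K sp f i l y) =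
      if e = f then G.actVtx K sp (G.r e) l y else 0 := by
  by_cases hs : G.start l y = G.r f
  swap
  · rw [Finset.sum_eq_zero (fun i _ => by rw [actRe_of_start_ne hs, map_zero])]
    split_ifs with h
    · rw [actVtx_of_ne (h ▸ hs)]
    · rfl
  have hrhs : (if e = f then G.actVtx K sp (G.r e) l y else 0) =
      if e = f then G.bas K sp l y else 0 := by
    split_ifs with h
    · rw [actVtx_of_start (h ▸ hs)]
    · rfl
  rw [hrhs]
  by_cases hred : f ∈ sp ∧ ∃ j l', l = .ghost f j :: l'
  swap
  · have hirr : ReIrr sp f l := fun h1 j l' hl' => hred ⟨h1, j, l', hl'⟩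
    rw [← sum_actGh_real hef hl hs hirr]
    exact Finset.sum_congr rfl fun i _ => by rw [actRe_of_irr hirr]
  obtain ⟨hf, j, l, rfl⟩ := hred
  have hw : G.vw (G.s e) = G.w f := by rw [hef, hsp.vw_eq hf]
  have hjf : j < G.w f := hl.1
  have hirr : ∀ g, G.s g = G.s f → G.GhIrr g j l := by
    rintro g hg rfl h l' hgh rfl
    exact hl.2.1.2 ⟨rfl, rfl⟩
  have hstart : G.start l y = G.s f := hl.2.1.tgt_eq.symm
  -- `g_j^*` does not reduce with `l` for any `g`, because `f_j^*` does not.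
  have hlow : ∀ g ∈ (G.out (G.s f)).erase f, ∑ i ∈ Finset.range (G.w f),
      G.extend K sp (G.actGh K sp e i) (G.bas K sp (.real g i :: .ghost g j :: l) y) =
      if e = g then G.bas K sp (.ghost g j :: l) y else 0 := by
    intro g hg
    rw [Finset.mem_erase, mem_out] at hg
    by_cases hjg : j < G.w g
    · rw [← hw]
      refine sum_actGh_real (hef.trans hg.2.symm)
        ⟨hjg, fitsList_gh (hirr g hg.2) (hstart.trans hg.2.symm), hl.2.2⟩ rfl ?_
      intro hgsp
      exact absurd (hsp.eq_of_mem g hgsp f hf hg.2) hg.1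
    · rw [bas_cons_eq_zero (G := G) (a := .ghost g j) hjg, ite_self]
      refine Finset.sum_eq_zero fun i _ => ?_
      rw [bas_cons_cons_eq_zero (G := G) (b := .ghost g j) hjg, map_zero]
  have hcalc : ∀ i ∈ Finset.range (G.w f), G.extend K sp (G.actGh K sp e i)
      (G.actRe K sp f i (.ghost f j :: l) y) =
      (if i = j then G.bas K sp (.ghost e j :: l) y else 0) -
        ∑ g ∈ (G.out (G.s f)).erase f, G.extend K sp (G.actGh K sp e i)
          (G.bas K sp (.real g i :: .ghost g j :: l) y) := by
    intro i hi
    rw [actRe, if_pos ⟨rfl, hf, Finset.mem_range.1 hi⟩, map_sub, map_sum]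
    congr 1
    split_ifs with hij
    · rw [extend_bas hl.2.2, hij, actGh_of_irr (hirr e hef)]
    · rw [map_zero]
  rw [hw, Finset.sum_congr rfl hcalc, Finset.sum_sub_distrib, Finset.sum_ite_eq',
    if_pos (Finset.mem_range.2 hjf), Finset.sum_comm, Finset.sum_congr rfl hlow, Finset.sum_ite_eq]
  by_cases h : e = f
  · subst h
    simp
  · rw [if_pos (Finset.mem_erase.2 ⟨h, G.mem_out.2 hef⟩), if_neg h, sub_self]

/-- The family of operators on the span of the normal words that represents the weighted Leavitt
path algebra. -/
noncomputable def fockFamily (K : Type k) [Field K] (hsp : G.IsSpecial sp) :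
    G.LeavittFamily (Module.End K (G.Fock K sp)) where
  vtx x := G.extend K sp (G.actVtx K sp x)
  re e i := G.extend K sp (G.actRe K sp e i)
  gh e i := G.extend K sp (G.actGh K sp e i)
  re_zero e i h := end_ext fun l y hl => by
    rw [extend_bas hl, actRe_eq_zero_of_le h, LinearMap.zero_apply]
  gh_zero e i h := end_ext fun l y hl => by
    rw [extend_bas hl, actGh_eq_zero_of_le h, LinearMap.zero_apply]
  vtx_mul_vtx x y := end_ext fun l z hl => by
    rw [Module.End.mul_apply]
    by_cases h : G.start l z = y
    · rw [vtx_bas h]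
      split_ifs with hxy
      · rfl
      · rw [vtx_bas_of_ne (fun h' => hxy (h'.symm.trans h)), LinearMap.zero_apply]
    · rw [vtx_bas_of_ne h, map_zero]
      split_ifs with hxy
      · rw [vtx_bas_of_ne (hxy ▸ h)]
      · rfl
  source_real e i _ := end_ext fun l y hl => by
    rw [Module.End.mul_apply, extend_bas hl, vtx_actRe e i hl]
  real_range e i _ := end_ext fun l y hl => by
    rw [Module.End.mul_apply]
    by_cases h : G.start l y = G.r e
    · rw [vtx_bas h]
    · rw [vtx_bas_of_ne h, map_zero, extend_bas hl, actRe_of_start_ne h]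
  range_ghost e i _ := end_ext fun l y hl => by
    rw [Module.End.mul_apply, extend_bas hl, vtx_actGh e i hl]
  ghost_source e i _ := end_ext fun l y hl => by
    rw [Module.End.mul_apply]
    by_cases h : G.start l y = G.s e
    · rw [vtx_bas h]
    · rw [vtx_bas_of_ne h, map_zero, extend_bas hl, actGh_of_start_ne h]
  real_ghost x i j hi hj := end_ext fun l y hl => by
    rw [LinearMap.sum_apply]
    simp only [Module.End.mul_apply, extend_bas hl]
    rw [sum_actRe_actGh hsp hi hj hl]
    split_ifs
    · rw [extend_bas hl]
    · rfl
  ghost_real e f hef := end_ext fun l y hl => by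
    rw [LinearMap.sum_apply]
    simp only [Module.End.mul_apply, extend_bas hl]
    rw [sum_actGh_actRe hsp hef hl]
    split_ifs
    · rw [extend_bas hl]
    · rfl

variable (G K) in
/-- The image of an arrow of the double graph in the weighted Leavitt path algebra. -/
noncomputable def val : Arrow E → G.WLPA K
  | .real e i => G.re K e i
  | .ghost e i => G.gh K e i

variable (G K) in
/-- The image of a word in the weighted Leavitt path algebra: the product of the arrows `l` and of
the vertex `y`. -/
noncomputable def word : List (Arrow E) → V → G.WLPA K
  | [], y => G.vtx K y
  | a :: l, y => G.val K a * word l y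

theorem lift_word_bas (hsp : G.IsSpecial sp) {l : List (Arrow E)} {y : V}
    (hl : G.IsNormal sp l y) :
    (fockFamily K hsp).lift (G.word K l y) (G.bas K sp [] y) = G.bas K sp l y := by
  induction l with
  | nil =>
    rw [word, LeavittFamily.lift_vtx]
    exact vtx_bas rfl
  | cons a l ih =>
    rw [word, map_mul, Module.End.mul_apply, ih hl.2.2]
    cases a with
    | real e i =>
      rw [val, LeavittFamily.lift_re]
      exact (extend_bas hl.2.2).trans (actRe_of_irr (reIrr_of_fitsList hl.2.1))
    | ghost e i =>
      rw [val, LeavittFamily.lift_gh]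
      exact (extend_bas hl.2.2).trans (actGh_of_irr (ghIrr_of_fitsList hl.2.1))

theorem lift_word_bas_of_ne (hsp : G.IsSpecial sp) {l : List (Arrow E)} {y z : V} (h : z ≠ y) :
    (fockFamily K hsp).lift (G.word K l y) (G.bas K sp [] z) = 0 := by
  induction l with
  | nil =>
    rw [word, LeavittFamily.lift_vtx]
    exact vtx_bas_of_ne h
  | cons a l ih => rw [word, map_mul, Module.End.mul_apply, ih, map_zero]

/-- The normal words are linearly independent in the weighted Leavitt path algebra. -/
theorem linearIndependent_word (hsp : G.IsSpecial sp) :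
    LinearIndependent K
      fun p : {p : List (Arrow E) × V // G.IsNormal sp p.1 p.2} => G.word K p.1.1 p.1.2 := by
  classical
  rw [linearIndependent_iff']
  intro t c hc p hp
  have h1 := congrArg (fun z => (fockFamily K hsp).lift z (G.bas K sp [] p.1.2) p) hc
  simp only [map_sum, map_smul, map_zero, LinearMap.sum_apply, LinearMap.smul_apply,
    LinearMap.zero_apply, Finsupp.coe_zero, Pi.zero_apply, Finsupp.finsetSum_apply,
    Finsupp.smul_apply, smul_eq_mul] at h1
  rw [Finset.sum_eq_single p] at h1
  · rw [lift_word_bas hsp p.2, bas, dif_pos p.2] at h1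
    simpa using h1
  · intro q _ hqp
    by_cases h : p.1.2 = q.1.2
    · rw [h, lift_word_bas hsp q.2, bas, dif_pos q.2, Finsupp.single_eq_of_ne, mul_zero]
      exact Ne.symm hqp
    · rw [lift_word_bas_of_ne hsp h, Finsupp.coe_zero, Pi.zero_apply, mul_zero]
  · exact fun h => absurd hp h

end WeightedGraph

/-! ### Consequences of local finiteness for the graph -/

namespace WeightedGraph

variable {V : Type u} {E : Type v} {G : WeightedGraph V E} {K : Type k} [Field K] {sp : Set E}

namespace Arrow

/-- The involution of the double graph that exchanges real and ghost edges. -/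
def star : Arrow E → Arrow E
  | .real e i => .ghost e i
  | .ghost e i => .real e i

@[simp] theorem star_star (a : Arrow E) : a.star.star = a := by cases a <;> rfl

/-- The standard degree of an arrow. -/
noncomputable def deg : Arrow E → (ℕ →₀ ℤ)
  | .real _ i => Finsupp.single i 1
  | .ghost _ i => -Finsupp.single i 1

theorem deg_star (a : Arrow E) : a.star.deg = -a.deg := by
  cases a <;> simp [star, deg]

end Arrow

/-- The word `l` read backwards, with real and ghost edges exchanged. -/
def starRev (l : List (Arrow E)) : List (Arrow E) := (l.map Arrow.star).reverse

/-- The total degree of a word, for a given degree of the arrows. -/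
noncomputable def wordDeg (δ : Arrow E → (ℕ →₀ ℤ)) (l : List (Arrow E)) : ℕ →₀ ℤ := (l.map δ).sum

@[simp] theorem wordDeg_nil (δ : Arrow E → (ℕ →₀ ℤ)) : wordDeg δ [] = 0 := rfl

@[simp] theorem wordDeg_cons (δ : Arrow E → (ℕ →₀ ℤ)) (a : Arrow E) (l : List (Arrow E)) :
    wordDeg δ (a :: l) = δ a + wordDeg δ l := by simp [wordDeg]

@[simp] theorem wordDeg_append (δ : Arrow E → (ℕ →₀ ℤ)) (l m : List (Arrow E)) :
    wordDeg δ (l ++ m) = wordDeg δ l + wordDeg δ m := by simp [wordDeg]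

theorem wordDeg_starRev (l : List (Arrow E)) :
    wordDeg Arrow.deg (starRev l) = -wordDeg Arrow.deg l := by
  induction l with
  | nil => simp [starRev]
  | cons a l ih =>
    have : starRev (a :: l) = starRev l ++ [a.star] := by simp [starRev]
    rw [this, wordDeg_append, ih]
    simp [Arrow.deg_star]

section Components

theorem mul_mem_component {g h : ℕ →₀ ℤ} {a b : G.WLPA K} (ha : a ∈ G.component K g)
    (hb : b ∈ G.component K h) : a * b ∈ G.component K (g + h) := by
  induction ha using Submodule.span_induction with
  | zero => rw [zero_mul]; exact zero_mem _
  | add x y _ _ hx hy => rw [add_mul]; exact add_mem hx hy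
  | smul c x _ hx => rw [smul_mul_assoc]; exact Submodule.smul_mem _ c hx
  | mem x hx =>
    obtain ⟨p, rfl, rfl⟩ := hx
    induction hb using Submodule.span_induction with
    | zero => rw [mul_zero]; exact zero_mem _
    | add x y _ _ hx hy => rw [mul_add]; exact add_mem hx hy
    | smul c x _ hx => rw [mul_smul_comm]; exact Submodule.smul_mem _ c hx
    | mem x hx =>
      obtain ⟨q, rfl, rfl⟩ := hx
      refine Submodule.subset_span ⟨p * q, ?_, ?_⟩
      · simp [degree]
      · rw [← QuotAlg.mk_mul, MonoidAlgebra.single_mul_single, one_mul]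

theorem letterVal_mem_component (a : G.Letter) :
    (letterVal a : G.WLPA K) ∈ G.component K (G.letterDegree a) :=
  Submodule.subset_span ⟨.of a, by simp [degree], (G.mk_of K a).symm⟩

theorem vtx_mem_component (x : V) : G.vtx K x ∈ G.component K 0 :=
  letterVal_mem_component (.vertex x)

theorem val_mem_component (a : Arrow E) : G.val K a ∈ G.component K a.deg := by
  cases a with
  | real e i =>
    by_cases h : i < G.w e
    · exact letterVal_mem_component (.real e ⟨i, h⟩)
    · rw [val, G.re_zero K e i (not_lt.1 h)]
      exact zero_mem _
  | ghost e i =>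
    by_cases h : i < G.w e
    · exact letterVal_mem_component (.ghost e ⟨i, h⟩)
    · rw [val, G.gh_zero K e i (not_lt.1 h)]
      exact zero_mem _

theorem word_mem_component (l : List (Arrow E)) (y : V) :
    G.word K l y ∈ G.component K (wordDeg Arrow.deg l) := by
  induction l with
  | nil => exact vtx_mem_component y
  | cons a l ih =>
    rw [wordDeg_cons]
    exact mul_mem_component (val_mem_component a) ih

/-- If the algebra is locally finite, then there are only finitely many normal words of each
degree. -/
theorem LocallyFinite.finite_isNormal (hG : G.LocallyFinite K) (hsp : G.IsSpecial sp)
    (g : ℕ →₀ ℤ) :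
    {p : List (Arrow E) × V | G.IsNormal sp p.1 p.2 ∧ wordDeg Arrow.deg p.1 = g}.Finite := by
  have hfin := hG g
  let φ : {p : List (Arrow E) × V // G.IsNormal sp p.1 p.2 ∧ wordDeg Arrow.deg p.1 = g} →
      G.component K g := fun p => ⟨G.word K p.1.1 p.1.2, by
      obtain ⟨p, -, rfl⟩ := p
      exact word_mem_component _ _⟩
  have hφ : LinearIndependent K φ := by
    refine LinearIndependent.of_comp (G.component K g).subtype ?_
    exact (linearIndependent_word (K := K) hsp).comp
      (fun p : {p : List (Arrow E) × V // G.IsNormal sp p.1 p.2 ∧ wordDeg Arrow.deg p.1 = g} =>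
        (⟨p.1, p.2.1⟩ : {p : List (Arrow E) × V // G.IsNormal sp p.1 p.2}))
      fun p q hpq => Subtype.ext (congrArg (fun z => z.1) hpq)
  exact Set.finite_coe_iff.1 hφ.finite_of_isNoetherian

theorem LocallyFinite.finite_vertices (hG : G.LocallyFinite K) (hsp : G.IsSpecial sp) :
    Finite V := by
  have h := hG.finite_isNormal hsp 0
  have := h.to_subtype
  exact Finite.of_injective
    (fun x : V => (⟨([], x), trivial, rfl⟩ :
      {p : List (Arrow E) × V | G.IsNormal sp p.1 p.2 ∧ wordDeg Arrow.deg p.1 = 0}))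
    fun x y hxy => congrArg (fun z => z.1.2) hxy

end Components

variable (G) in
/-- The list `l` consists of the arrows of a normal word, whose end vertex is left open. -/
def NormalList (sp : Set E) (l : List (Arrow E)) : Prop :=
  (∀ a ∈ l, G.Valid a) ∧ l.IsChain (G.Fits sp)

theorem NormalList.exists_isNormal {l : List (Arrow E)} (h : G.NormalList sp l) :
    ∃ y, G.IsNormal sp l y := by
  obtain ⟨hv, hc⟩ := h
  induction l with
  | nil => exact ⟨G.nonempty.some, trivial⟩
  | cons a l ih =>
    obtain ⟨y, hy⟩ := ih (fun b hb => hv b (List.mem_cons_of_mem _ hb)) hc.tail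
    cases l with
    | nil => exact ⟨G.tgt a, hv a (by simp), rfl, trivial⟩
    | cons b l => exact ⟨y, hv a (by simp), (List.isChain_cons_cons.1 hc).1, hy⟩

theorem NormalList.append {l m : List (Arrow E)} (hl : G.NormalList sp l)
    (hm : G.NormalList sp m) (h : ∀ a ∈ l.getLast?, ∀ b ∈ m.head?, G.Fits sp a b) :
    G.NormalList sp (l ++ m) :=
  ⟨fun a ha => (List.mem_append.1 ha).elim (hl.1 a) (hm.1 a),
    List.isChain_append.2 ⟨hl.2, hm.2, h⟩⟩

theorem Valid.star {a : Arrow E} (h : G.Valid a) : G.Valid a.star := by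
  cases a <;> exact h

theorem Fits.star {a b : Arrow E} (h : G.Fits sp a b) : G.Fits sp b.star a.star := by
  cases a <;> cases b
  · exact h.symm
  · refine ⟨h.1.symm, ?_⟩
    rintro ⟨rfl, h1⟩
    exact h.2 ⟨rfl, h1⟩
  · exact ⟨h.1.symm, fun h1 => h.2 h1.symm⟩
  · exact h.symm

theorem NormalList.starRev {l : List (Arrow E)} (hl : G.NormalList sp l) :
    G.NormalList sp (starRev l) := by
  constructor
  · intro a ha
    simp only [WeightedGraph.starRev, List.mem_reverse, List.mem_map] at ha
    obtain ⟨b, hb, rfl⟩ := ha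
    exact (hl.1 b hb).star
  · rw [WeightedGraph.starRev, List.isChain_reverse, List.isChain_map]
    exact hl.2.imp fun a b h => h.star

/-- Infinitely many normal words of degree zero contradict local finiteness. -/
theorem LocallyFinite.false_of_strictMono (hG : G.LocallyFinite K) (hsp : G.IsSpecial sp)
    {f : ℕ → List (Arrow E)} (hf : StrictMono fun n => (f n).length) (hn : ∀ n, G.NormalList sp (f n))
    (hd : ∀ n, wordDeg Arrow.deg (f n) = 0) : False := by
  choose y hy using fun n => (hn n).exists_isNormal
  refine Set.infinite_of_injective_forall_mem (f := fun n => (f n, y n)) (fun m n hmn => ?_)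
    (fun n => ?_) (hG.finite_isNormal hsp 0)
  · exact hf.injective (congrArg (fun p => p.1.length) hmn)
  · exact ⟨hy n, hd n⟩

variable (G) in
/-- A normal word of degree zero that starts with the arrow `a` and ends with `a^*`. -/
structure IsLoop (sp : Set E) (a : Arrow E) (l : List (Arrow E)) : Prop where
  normal : G.NormalList sp l
  head : l.head? = some a
  last : l.getLast? = some a.star
  deg : wordDeg Arrow.deg l = 0

/-- If the last arrow `a` of a normal word `l` fits to `a^*`, then `l l^*` is a normal word. -/
theorem NormalList.isLoop {a : Arrow E} {l : List (Arrow E)} (hl : G.NormalList sp (a :: l))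
    (h : ∀ b ∈ (a :: l).getLast?, G.Fits sp b b.star) :
    G.IsLoop sp a (a :: l ++ WeightedGraph.starRev (a :: l)) where
  normal := by
    refine hl.append hl.starRev ?_
    intro b hb c hc
    have hc' : c = b.star := by
      rw [WeightedGraph.starRev, List.head?_reverse, List.getLast?_map, hb] at hc
      simpa using hc.symm
    rw [hc']
    exact h b hb
  head := rfl
  last := by
    rw [WeightedGraph.starRev, List.getLast?_append, List.getLast?_reverse]
    rfl
  deg := by rw [wordDeg_append, wordDeg_starRev, add_neg_cancel]

/-- If two loops can be composed in both orders, then the powers of their product are infinitely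
many normal words of degree zero. -/
theorem LocallyFinite.false_of_isLoop (hG : G.LocallyFinite K) (hsp : G.IsSpecial sp)
    {a b : Arrow E} {l m : List (Arrow E)} (hl : G.IsLoop sp a l) (hm : G.IsLoop sp b m)
    (hab : G.Fits sp a.star b) (hba : G.Fits sp b.star a) : False := by
  have hl0 : l ≠ [] := by
    rintro rfl
    simpa using hl.head
  have hm0 : m ≠ [] := by
    rintro rfl
    simpa using hm.head
  have hlast : (l ++ m).getLast? = some b.star := by
    rw [List.getLast?_append, hm.last]; rfl
  have hz : G.NormalList sp (l ++ m) := by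
    refine hl.normal.append hm.normal ?_
    rw [hl.last, hm.head]
    rintro _ ⟨⟩ _ ⟨⟩
    exact hab
  let f : ℕ → List (Arrow E) := fun n => n.rec [] fun _ w => (l ++ m) ++ w
  have hf : ∀ n, f (n + 1) = (l ++ m) ++ f n := fun n => rfl
  have hhead : ∀ n, ∀ c ∈ (f n).head?, c = a := by
    intro n c hc
    cases n with
    | zero => simp [f] at hc
    | succ n =>
      rw [hf, List.head?_append, List.head?_append, hl.head] at hc
      simpa using hc.symm
  refine hG.false_of_strictMono hsp (f := f) ?_ ?_ ?_
  · refine strictMono_nat_of_lt_succ fun n => ?_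
    have := List.length_pos_iff.2 hl0
    simp only [hf, List.length_append]
    omega
  · intro n
    induction n with
    | zero => exact ⟨by simp [f], by simp [f]⟩
    | succ n ih =>
      rw [hf]
      refine hz.append ih ?_
      rw [hlast]
      rintro _ ⟨⟩ c hc
      rw [hhead n c hc]
      exact hba
  · intro n
    induction n with
    | zero => rfl
    | succ n ih => rw [hf, wordDeg_append, wordDeg_append, hl.deg, hm.deg, ih]; simp

theorem exists_isSpecial (G : WeightedGraph V E) : ∃ sp : Set E, G.IsSpecial sp := by
  have h : ∀ e, ∃ m, G.s m = G.s e ∧ ∀ f, G.s f = G.s e → G.w f ≤ G.w m := by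
    intro e
    obtain ⟨m, hm, hmax⟩ := Finset.exists_max_image (G.out (G.s e)) G.w ⟨e, G.mem_out.2 rfl⟩
    exact ⟨m, G.mem_out.1 hm, fun f hf => hmax f (G.mem_out.2 hf)⟩
  have h' : ∀ x : Set.range G.s, ∃ m, G.s m = x ∧ ∀ f, G.s f = x → G.w f ≤ G.w m := by
    rintro ⟨_, e, rfl⟩
    exact h e
  choose m hm hmax using h'
  refine ⟨Set.range m, ?_, ?_, ?_⟩
  · exact fun e => ⟨m ⟨G.s e, e, rfl⟩, ⟨_, rfl⟩, hm _⟩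
  · rintro _ ⟨x, rfl⟩ _ ⟨y, rfl⟩ hxy
    rw [hm, hm] at hxy
    rw [Subtype.ext hxy]
  · rintro _ ⟨x, rfl⟩ f hf
    exact hmax x f (hf.trans (hm x))

variable (G) in
/-- The vertices that can be reached from the range of a weighted edge. -/
inductive InTail : V → Prop
  | range (e : E) (he : 1 < G.w e) : InTail (G.r e)
  | step (f : E) (hf : InTail (G.s f)) : InTail (G.r f)

variable (G) in
/-- The edges that are weighted or start at a vertex reachable from the range of a weighted
edge. -/
def tailEdges : Set E := {h | 1 < G.w h ∨ G.InTail (G.s h)}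

theorem inTail_range {h : E} (hh : h ∈ G.tailEdges) : G.InTail (G.r h) :=
  hh.elim (.range h) (.step h)

theorem InTail.exists_edge {x : V} (hx : G.InTail x) : ∃ h ∈ G.tailEdges, G.r h = x := by
  cases hx with
  | range e he => exact ⟨e, .inl he, rfl⟩
  | step f hf => exact ⟨f, .inr hf, rfl⟩

/-- Going back along edges from `h` to a weighted edge `e`, ending with `e_2^*`, and returning the
same way yields a loop. The turn `e_2^* e_2` is normal since the index is not the first one. -/
theorem exists_isLoop_ghost {h : E} (hh : h ∈ G.tailEdges) :
    ∃ i l, G.IsLoop sp (.ghost h i) l := by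
  have key : ∀ x, G.InTail x → ∀ h, G.s h = x → ∃ l, G.NormalList sp (.ghost h 0 :: l) ∧
      ∀ b ∈ (Arrow.ghost h 0 :: l).getLast?, G.Fits sp b b.star := by
    intro x hx
    induction hx with
    | range e he =>
      intro h hh
      refine ⟨[.ghost e 1], ⟨?_, ?_⟩, ?_⟩
      · simpa [Valid] using ⟨G.w_pos h, he⟩
      · exact List.isChain_cons_cons.2 ⟨hh, by simp⟩
      · rintro _ ⟨⟩
        exact ⟨rfl, by simp⟩
    | step f hf ih =>
      intro h hh
      obtain ⟨l, hl, hlast⟩ := ih f rfl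
      refine ⟨.ghost f 0 :: l, ⟨?_, ?_⟩, ?_⟩
      · intro a ha
        rcases List.mem_cons.1 ha with rfl | ha
        · exact G.w_pos h
        · exact hl.1 a ha
      · exact List.isChain_cons_cons.2 ⟨hh, hl.2⟩
      · rwa [List.getLast?_cons_cons]
  rcases hh with hh | hh
  · refine ⟨1, _, NormalList.isLoop (l := []) ⟨by simpa [Valid] using hh, by simp⟩ ?_⟩
    rintro _ ⟨⟩
    exact ⟨rfl, by simp⟩
  · obtain ⟨l, hl, hlast⟩ := key _ hh h rfl
    exact ⟨0, _, hl.isLoop hlast⟩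

theorem isLoop_real {g : E} (hg : g ∉ sp) :
    G.IsLoop sp (.real g 0) [.real g 0, .ghost g 0] := by
  refine NormalList.isLoop (l := []) ⟨by simpa [Valid] using G.w_pos g, by simp⟩ ?_
  rintro _ ⟨⟩
  exact ⟨rfl, fun h => hg h.2⟩

/-- A vertex reachable from the range of a weighted edge emits at most one edge: a nonspecial edge
`g` at this vertex yields the loop `g_1 g_1^*`, which can be composed with the loop of
`exists_isLoop_ghost`. -/
theorem LocallyFinite.eq_of_inTail (hG : G.LocallyFinite K) {g g' : E} (hg : G.InTail (G.s g))
    (hgg' : G.s g = G.s g') : g = g' := by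
  obtain ⟨sp, hsp⟩ := G.exists_isSpecial
  obtain ⟨h, hh, hr⟩ := hg.exists_edge
  obtain ⟨i, l, hl⟩ := exists_isLoop_ghost (sp := sp) hh
  have key : ∀ f, G.s f = G.s g → f ∈ sp := fun f hf => by
    by_contra hfs
    exact hG.false_of_isLoop hsp hl (isLoop_real hfs) (hr.trans hf.symm) (hf.trans hr.symm)
  exact hsp.eq_of_mem g (key g rfl) g' (key g' hgg'.symm) hgg'

/-- Two different edges that are weighted or start at a vertex reachable from the range of a
weighted edge have different ranges: otherwise the loops of `exists_isLoop_ghost` for the two edges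
can be composed. -/
theorem LocallyFinite.range_injOn (hG : G.LocallyFinite K) : Set.InjOn G.r G.tailEdges := by
  intro h hh h' hh' hr
  obtain ⟨sp, hsp⟩ := G.exists_isSpecial
  obtain ⟨i, l, hl⟩ := exists_isLoop_ghost (sp := sp) hh
  obtain ⟨i', l', hl'⟩ := exists_isLoop_ghost (sp := sp) hh'
  by_contra hne
  exact hG.false_of_isLoop hsp hl hl' ⟨hr, fun h => hne h.1⟩ ⟨hr.symm, fun h => hne h.1.symm⟩

/-- A weighted edge `e` is special for every choice of special edges: otherwise the powers of
`e_2^* e_1 e_1^* e_2` are normal words of degree zero. -/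
theorem LocallyFinite.mem_of_weighted (hG : G.LocallyFinite K) (hsp : G.IsSpecial sp) {e : E}
    (he : 1 < G.w e) : e ∈ sp := by
  by_contra hes
  have hl : G.IsLoop sp (.ghost e 1) _ :=
    NormalList.isLoop (l := [.real e 0]) ⟨by simpa [Valid] using ⟨he, G.w_pos e⟩,
      by simp [Fits]⟩ (by rintro _ ⟨⟩; exact ⟨rfl, fun h => hes h.2⟩)
  exact hG.false_of_isLoop hsp hl hl ⟨rfl, fun h => hes h.2⟩ ⟨rfl, fun h => hes h.2⟩

/-- A vertex emits at most one weighted edge. -/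
theorem LocallyFinite.eq_of_weighted (hG : G.LocallyFinite K) {e f : E} (he : 1 < G.w e)
    (hf : 1 < G.w f) (hef : G.s e = G.s f) : e = f := by
  obtain ⟨sp, hsp⟩ := G.exists_isSpecial
  exact hsp.eq_of_mem e (hG.mem_of_weighted hsp he) f (hG.mem_of_weighted hsp hf) hef

end WeightedGraph

/-! ### Reversing edges -/

namespace WeightedGraph

variable {V : Type u} {E : Type v} {G : WeightedGraph V E} {K : Type k} [Field K]

theorem out_eq_singleton {h : E} (hs : ∀ f, G.s f = G.s h → f = h) : G.out (G.s h) = {h} := by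
  ext f
  rw [mem_out, Finset.mem_singleton]
  exact ⟨hs f, fun hf => hf ▸ rfl⟩

theorem vw_of_sole {h : E} (hs : ∀ f, G.s f = G.s h → f = h) : G.vw (G.s h) = G.w h := by
  rw [vw, out_eq_singleton hs, Finset.sup_singleton]

open Classical in
theorem re_mul_gh_of_sole {h : E} (hs : ∀ f, G.s f = G.s h → f = h) {i j : ℕ} (hi : i < G.w h)
    (hj : j < G.w h) : G.re K h i * G.gh K h j = if i = j then G.vtx K (G.s h) else 0 := by
  rw [← vw_of_sole hs] at hi hj
  have := G.sum_re_mul_gh K (G.s h) i j hi hj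
  rwa [out_eq_singleton hs, Finset.sum_singleton] at this

theorem sum_gh_mul_re_of_sole {h : E} (hs : ∀ f, G.s f = G.s h → f = h) :
    ∑ i ∈ Finset.range (G.w h), G.gh K h i * G.re K h i = G.vtx K (G.r h) := by
  have := G.sum_gh_mul_re K h h rfl
  rwa [vw_of_sole hs, if_pos rfl] at this

variable (G) in
/-- A set `R` of edges that can be reversed without changing the weighted Leavitt path algebra:
each edge in `R` is the only edge emitted by its source and the only edge in `R` received by its
range, and its range emits only edges in `R`. -/
structure IsReversible (R : Set E) : Prop where
  sole : ∀ h ∈ R, ∀ f, G.s f = G.s h → f = h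
  injOn : Set.InjOn G.r R
  mem_of_source : ∀ h ∈ R, ∀ f, G.s f = G.r h → f ∈ R

variable (G) in
/-- The edges of the graph in which the edges in `R` are reversed: the edges outside `R`, and
`w(h)` edges for each `h` in `R`. -/
abbrev RevEdge (R : Set E) : Type v := {e : E // e ∉ R} ⊕ (Σ h : R, Fin (G.w h))

/-- The weighted graph in which each edge `h` in `R` is replaced by `w(h)` edges of weight one from
`r(h)` to `s(h)`. -/
def reverse (G : WeightedGraph V E) (R : Set E) (hR : G.IsReversible R) :
    WeightedGraph V (G.RevEdge R) where
  s := Sum.elim (fun e => G.s e) fun p => G.r p.1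
  r := Sum.elim (fun e => G.r e) fun p => G.s p.1
  w := Sum.elim (fun e => G.w e) fun _ => 1
  one_le_w := by
    rintro (e | p)
    · exact G.one_le_w e
    · exact le_rfl
  rowFinite x := by
    have h1 : {e : G.RevEdge R | ∃ f, e = .inl f ∧ G.s f = x}.Finite := by
      refine (((G.rowFinite x).preimage (f := fun e : {e // e ∉ R} => (e : E))
        Subtype.val_injective.injOn).image Sum.inl).subset ?_
      rintro _ ⟨f, rfl, hf⟩
      exact ⟨f, hf, rfl⟩
    have h2 : {e : G.RevEdge R | ∃ p : Σ h : R, Fin (G.w h), e = .inr p ∧ G.r p.1 = x}.Finite := by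
      by_cases hx : ∃ h : R, G.r h = x
      · obtain ⟨h, rfl⟩ := hx
        refine (Set.finite_range fun i : Fin (G.w h) => (.inr ⟨h, i⟩ : G.RevEdge R)).subset ?_
        rintro _ ⟨⟨h', i⟩, rfl, hp⟩
        obtain rfl : h' = h := Subtype.ext (hR.injOn h'.2 h.2 hp)
        exact ⟨i, rfl⟩
      · refine Set.finite_empty.subset ?_
        rintro _ ⟨p, rfl, hp⟩
        exact hx ⟨p.1, hp⟩
    refine (h1.union h2).subset ?_
    rintro (e | p) he
    · exact .inl ⟨e, rfl, he⟩
    · exact .inr ⟨p, rfl, he⟩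
  nonempty := G.nonempty

namespace IsReversible

variable {R : Set E} (hR : G.IsReversible R)

theorem notMem_of_source_eq (hR : G.IsReversible R) {e f : E} (he : e ∉ R) (hef : G.s f = G.s e) : f ∉ R :=
  fun hf => he (hR.sole f hf e hef.symm ▸ hf)

theorem source_ne_range (hR : G.IsReversible R) {e h : E} (he : e ∉ R) (hh : h ∈ R) : G.s e ≠ G.r h :=
  fun h' => he (hR.mem_of_source h hh e h')

/-- At a vertex that emits an edge outside `R`, nothing changes when `R` is reversed. -/
theorem sum_out_source {A : Type*} [AddCommMonoid A] {e : E} (he : e ∉ R)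
    {f : G.RevEdge R → A} {g : E → A} (hfg : ∀ e', f (.inl e') = g e') :
    ∑ e' ∈ (G.reverse R hR).out (G.s e), f e' = ∑ e' ∈ G.out (G.s e), g e' := by
  symm
  refine Finset.sum_bij (fun e' he' => .inl ⟨e', hR.notMem_of_source_eq he (G.mem_out.1 he')⟩)
    (fun e' he' => (mem_out _).2 (G.mem_out.1 he')) (fun _ _ _ _ h => ?_) ?_
    (fun e' he' => (hfg ⟨e', _⟩).symm)
  · simpa using h
  · rintro (e' | p) hp
    · exact ⟨e', G.mem_out.2 ((mem_out (G.reverse R hR)).1 hp), rfl⟩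
    · exact absurd ((mem_out (G.reverse R hR)).1 hp).symm (hR.source_ne_range he p.1.2)

/-- The edges that the range of `h ∈ R` emits after the reversal are the reversals of `h`. -/
theorem sum_out_range {A : Type*} [AddCommMonoid A] (h : R) (f : G.RevEdge R → A) :
    ∑ e' ∈ (G.reverse R hR).out (G.r h), f e' = ∑ i : Fin (G.w h), f (.inr ⟨h, i⟩) := by
  symm
  refine Finset.sum_bij (fun i _ => .inr ⟨h, i⟩) (fun i _ => (mem_out _).2 rfl)
    (fun _ _ _ _ h => ?_) ?_ (fun _ _ => rfl)
  · simpa using h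
  · rintro (e' | ⟨h', i⟩) hp
    · exact absurd ((mem_out (G.reverse R hR)).1 hp) (hR.source_ne_range e'.2 h.2)
    · obtain rfl : h' = h := Subtype.ext (hR.injOn h'.2 h.2 ((mem_out (G.reverse R hR)).1 hp))
      exact ⟨i, Finset.mem_univ _, rfl⟩

theorem vw_source {e : E} (he : e ∉ R) : (G.reverse R hR).vw (G.s e) = G.vw (G.s e) := by
  refine le_antisymm (Finset.sup_le ?_) (Finset.sup_le fun f hf => ?_)
  · rintro (f | p) hf
    · have hf' : G.s f = G.s e := (mem_out (G.reverse R hR)).1 hf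
      exact hf' ▸ G.w_le_vw f
    · exact absurd ((mem_out (G.reverse R hR)).1 hf).symm (hR.source_ne_range he p.1.2)
  · exact Finset.le_sup (f := (G.reverse R hR).w)
      (b := .inl ⟨f, hR.notMem_of_source_eq he (G.mem_out.1 hf)⟩)
      ((mem_out _).2 (G.mem_out.1 hf))

theorem vw_range {h : E} (hh : h ∈ R) : (G.reverse R hR).vw (G.r h) = 1 := by
  refine le_antisymm (Finset.sup_le ?_) ?_
  · rintro (f | p) hf
    · exact absurd ((mem_out (G.reverse R hR)).1 hf) (hR.source_ne_range f.2 hh)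
    · exact le_rfl
  · exact w_le_vw (G.reverse R hR) (.inr ⟨⟨h, hh⟩, ⟨0, G.w_pos h⟩⟩)

/-- A nonsink of the reversed graph either emits an edge outside `R` or is the range of an edge in
`R`. -/
theorem exists_of_vw_pos {x : V} (hx : 0 < (G.reverse R hR).vw x) :
    (∃ e ∉ R, G.s e = x) ∨ ∃ h ∈ R, G.r h = x := by
  obtain ⟨e | p, he, -⟩ := Finset.lt_sup_iff.1 hx
  · exact .inl ⟨e, e.2, (mem_out (G.reverse R hR)).1 he⟩
  · exact .inr ⟨p.1, p.1.2, (mem_out (G.reverse R hR)).1 he⟩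

/-- The elements of the weighted Leavitt path algebra of `G` that correspond to the generators for
the reversed graph: the reversals of `h` are the ghost edges `h_i^*`. -/
noncomputable def toFamily (K : Type k) [Field K] :
    (G.reverse R hR).LeavittFamily (G.WLPA K) where
  vtx := G.vtx K
  re := Sum.elim (fun e i => G.re K e i) fun p i => if i = 0 then G.gh K p.1 p.2 else 0
  gh := Sum.elim (fun e i => G.gh K e i) fun p i => if i = 0 then G.re K p.1 p.2 else 0
  re_zero := by
    rintro (e | p) i hi
    · exact G.re_zero K e i hi
    · exact if_neg (Nat.one_le_iff_ne_zero.1 hi)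
  gh_zero := by
    rintro (e | p) i hi
    · exact G.gh_zero K e i hi
    · exact if_neg (Nat.one_le_iff_ne_zero.1 hi)
  vtx_mul_vtx := G.vtx_mul_vtx K
  source_real := by
    rintro (e | p) i hi
    · exact G.source_mul_re K e i
    · obtain rfl : i = 0 := Nat.lt_one_iff.1 hi
      exact G.range_mul_gh K _ _
  real_range := by
    rintro (e | p) i hi
    · exact G.re_mul_range K e i
    · obtain rfl : i = 0 := Nat.lt_one_iff.1 hi
      exact G.gh_mul_source K _ _
  range_ghost := by
    rintro (e | p) i hi
    · exact G.range_mul_gh K e i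
    · obtain rfl : i = 0 := Nat.lt_one_iff.1 hi
      exact G.source_mul_re K _ _
  ghost_source := by
    rintro (e | p) i hi
    · exact G.gh_mul_source K e i
    · obtain rfl : i = 0 := Nat.lt_one_iff.1 hi
      exact G.re_mul_range K _ _
  real_ghost x i j hi hj := by
    rcases hR.exists_of_vw_pos (Nat.zero_lt_of_lt hi) with ⟨e, he, rfl⟩ | ⟨h, hh, rfl⟩
    · rw [hR.vw_source he] at hi hj
      rw [← G.sum_re_mul_gh K (G.s e) i j hi hj]
      exact hR.sum_out_source he fun e' => rfl
    · rw [hR.vw_range hh, Nat.lt_one_iff] at hi hj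
      subst hi hj
      rw [if_pos rfl, ← sum_gh_mul_re_of_sole (hR.sole h hh), Finset.sum_range]
      exact hR.sum_out_range ⟨h, hh⟩ _
  ghost_real := by
    classical
    rintro (e | ⟨h, i⟩) (f | ⟨h', i'⟩) hef
    · have hw : (G.reverse R hR).vw (G.s e) = G.vw (G.s e) := hR.vw_source e.2
      refine (congrArg (fun n => ∑ i ∈ Finset.range n, G.gh K e i * G.re K f i) hw).trans ?_
      rw [G.sum_gh_mul_re K e f hef]
      by_cases h : e = f
      · subst h
        rw [if_pos rfl, if_pos rfl]
        rfl
      · rw [if_neg (fun h' => h (Subtype.ext h')), if_neg (fun h' => h (Sum.inl_injective h'))]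
    · exact absurd hef (hR.source_ne_range e.2 h'.2)
    · exact absurd hef.symm (hR.source_ne_range f.2 h.2)
    · obtain rfl : h = h' := Subtype.ext (hR.injOn h.2 h'.2 hef)
      have hw : (G.reverse R hR).vw ((G.reverse R hR).s (.inr ⟨h, i⟩)) = 1 := hR.vw_range h.2
      rw [hw, Finset.sum_range_one]
      refine (re_mul_gh_of_sole (hR.sole h h.2) i.2 i'.2).trans ?_
      by_cases hi : i = i'
      · subst hi
        rw [if_pos rfl, if_pos rfl]
        rfl
      · rw [if_neg (fun h' => hi (Fin.ext h')), if_neg (fun h' => hi ?_)]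
        simpa using h'

/-- In the algebra of the reversed graph, the reversals of `h` satisfy the relations of the ghost
edges `h_i^*`. -/
theorem gh_mul_re_inr (h : R) (i j : Fin (G.w h)) [Decidable (i = j)] :
    (G.reverse R hR).gh K (.inr ⟨h, i⟩) 0 * (G.reverse R hR).re K (.inr ⟨h, j⟩) 0 =
      if i = j then (G.reverse R hR).vtx K (G.s h) else 0 := by
  have := (G.reverse R hR).sum_gh_mul_re K (.inr ⟨h, i⟩) (.inr ⟨h, j⟩) rfl
  have hw : (G.reverse R hR).vw ((G.reverse R hR).s (.inr ⟨h, i⟩)) = 1 := hR.vw_range h.2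
  rw [hw, Finset.sum_range_one] at this
  rw [this]
  by_cases hi : i = j
  · subst hi
    rw [if_pos rfl, if_pos rfl]
    rfl
  · rw [if_neg hi, if_neg (fun h' => hi ?_)]
    simpa using h'

open Classical in
/-- The elements of the weighted Leavitt path algebra of the reversed graph that correspond to the
generators for `G`. -/
noncomputable def ofFamily (K : Type k) [Field K] :
    G.LeavittFamily ((G.reverse R hR).WLPA K) where
  vtx := (G.reverse R hR).vtx K
  re e i :=
    if he : e ∈ R then
      if hi : i < G.w e then (G.reverse R hR).gh K (.inr ⟨⟨e, he⟩, ⟨i, hi⟩⟩) 0 else 0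
    else (G.reverse R hR).re K (.inl ⟨e, he⟩) i
  gh e i :=
    if he : e ∈ R then
      if hi : i < G.w e then (G.reverse R hR).re K (.inr ⟨⟨e, he⟩, ⟨i, hi⟩⟩) 0 else 0
    else (G.reverse R hR).gh K (.inl ⟨e, he⟩) i
  re_zero e i hi := by
    by_cases he : e ∈ R
    · rw [dif_pos he, dif_neg (not_lt.2 hi)]
    · rw [dif_neg he]
      exact re_zero _ K _ _ hi
  gh_zero e i hi := by
    by_cases he : e ∈ R
    · rw [dif_pos he, dif_neg (not_lt.2 hi)]
    · rw [dif_neg he]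
      exact gh_zero _ K _ _ hi
  vtx_mul_vtx := (G.reverse R hR).vtx_mul_vtx K
  source_real e i hi := by
    by_cases he : e ∈ R
    · rw [dif_pos he, dif_pos hi]
      exact range_mul_gh _ K _ _
    · rw [dif_neg he]
      exact source_mul_re _ K _ _
  real_range e i hi := by
    by_cases he : e ∈ R
    · rw [dif_pos he, dif_pos hi]
      exact gh_mul_source _ K _ _
    · rw [dif_neg he]
      exact re_mul_range _ K _ _
  range_ghost e i hi := by
    by_cases he : e ∈ R
    · rw [dif_pos he, dif_pos hi]
      exact source_mul_re _ K _ _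
    · rw [dif_neg he]
      exact range_mul_gh _ K _ _
  ghost_source e i hi := by
    by_cases he : e ∈ R
    · rw [dif_pos he, dif_pos hi]
      exact re_mul_range _ K _ _
    · rw [dif_neg he]
      exact gh_mul_source _ K _ _
  real_ghost x i j hi hj := by
    obtain ⟨e, he, -⟩ := Finset.lt_sup_iff.1 (Nat.zero_lt_of_lt hi)
    rw [mem_out] at he
    subst he
    by_cases he : e ∈ R
    · rw [vw_of_sole (hR.sole e he)] at hi hj
      rw [out_eq_singleton (hR.sole e he), Finset.sum_singleton, dif_pos he, dif_pos hi,
        dif_pos he, dif_pos hj]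
      refine (hR.gh_mul_re_inr ⟨e, he⟩ ⟨i, hi⟩ ⟨j, hj⟩).trans ?_
      simp only [Fin.mk.injEq]
    · rw [← hR.vw_source he] at hi hj
      rw [← (G.reverse R hR).sum_re_mul_gh K (G.s e) i j hi hj]
      refine (hR.sum_out_source he fun e' => ?_).symm
      rw [dif_neg e'.2, dif_neg e'.2]
  ghost_real e f hef := by
    by_cases he : e ∈ R
    · obtain rfl := hR.sole e he f hef.symm
      have := (G.reverse R hR).sum_re_mul_gh K (G.r f) 0 0 (by rw [hR.vw_range he]; omega)
        (by rw [hR.vw_range he]; omega)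
      rw [if_pos rfl] at this ⊢
      rw [← this, hR.sum_out_range ⟨f, he⟩, vw_of_sole (hR.sole f he), Finset.sum_range]
      refine Finset.sum_congr rfl fun i _ => ?_
      rw [dif_pos he, dif_pos i.2, dif_pos he, dif_pos i.2]
    · have hf : f ∉ R := hR.notMem_of_source_eq he hef.symm
      have := (G.reverse R hR).sum_gh_mul_re K (.inl ⟨e, he⟩) (.inl ⟨f, hf⟩) hef
      have hw : (G.reverse R hR).vw ((G.reverse R hR).s (.inl ⟨e, he⟩)) = G.vw (G.s e) :=
        hR.vw_source he
      rw [hw] at this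
      simp only [dif_neg he, dif_neg hf]
      rw [this]
      by_cases h : e = f
      · subst h
        rw [if_pos rfl, if_pos rfl]
        rfl
      · rw [if_neg h, if_neg (fun h' => h ?_)]
        simpa using h'

/-- Reversing the edges in `R` does not change the weighted Leavitt path algebra. -/
theorem bijective_lift : Function.Bijective ((hR.toFamily K).lift (K := K)) := by
  have h1 : ((hR.ofFamily K).lift (K := K)).comp ((hR.toFamily K).lift (K := K)) =
      NonUnitalAlgHom.id K _ := by
    refine algHom_ext _ (fun x => ?_) ?_ ?_
    · simp only [NonUnitalAlgHom.comp_apply, LeavittFamily.lift_vtx]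
      exact (hR.ofFamily K).lift_vtx x
    · rintro (e | p) i
      · simp only [NonUnitalAlgHom.comp_apply, LeavittFamily.lift_re]
        refine ((hR.ofFamily K).lift_re e i).trans ?_
        simp [ofFamily, e.2]
      · simp only [NonUnitalAlgHom.comp_apply, LeavittFamily.lift_re]
        by_cases hi : i = 0
        · subst hi
          refine ((hR.ofFamily K).lift_gh _ _).trans ?_
          simp [ofFamily]
        · have : (hR.toFamily K).re (.inr p) i = 0 := if_neg hi
          rw [this, map_zero]
          exact (re_zero _ K _ _ (Nat.one_le_iff_ne_zero.2 hi)).symm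
    · rintro (e | p) i
      · simp only [NonUnitalAlgHom.comp_apply, LeavittFamily.lift_gh]
        refine ((hR.ofFamily K).lift_gh e i).trans ?_
        simp [ofFamily, e.2]
      · simp only [NonUnitalAlgHom.comp_apply, LeavittFamily.lift_gh]
        by_cases hi : i = 0
        · subst hi
          refine ((hR.ofFamily K).lift_re _ _).trans ?_
          simp [ofFamily]
        · have : (hR.toFamily K).gh (.inr p) i = 0 := if_neg hi
          rw [this, map_zero]
          exact (gh_zero _ K _ _ (Nat.one_le_iff_ne_zero.2 hi)).symm
  have h2 : ((hR.toFamily K).lift (K := K)).comp ((hR.ofFamily K).lift (K := K)) =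
      NonUnitalAlgHom.id K _ := by
    refine algHom_ext _ (fun x => ?_) (fun e i => ?_) (fun e i => ?_)
    · simp only [NonUnitalAlgHom.comp_apply, LeavittFamily.lift_vtx]
      exact (hR.toFamily K).lift_vtx x
    · simp only [NonUnitalAlgHom.comp_apply, LeavittFamily.lift_re, ofFamily]
      split_ifs with he hi
      · exact ((hR.toFamily K).lift_gh _ _).trans (by simp [toFamily])
      · rw [map_zero]
        exact (G.re_zero K e i (not_lt.1 hi)).symm
      · exact (hR.toFamily K).lift_re _ _
    · simp only [NonUnitalAlgHom.comp_apply, LeavittFamily.lift_gh, ofFamily]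
      split_ifs with he hi
      · exact ((hR.toFamily K).lift_re _ _).trans (by simp [toFamily])
      · rw [map_zero]
        exact (G.gh_zero K e i (not_lt.1 hi)).symm
      · exact (hR.toFamily K).lift_gh _ _
  exact Function.bijective_iff_has_inverse.2 ⟨(hR.ofFamily K).lift,
    fun x => congrArg (fun φ => φ x) h1, fun x => congrArg (fun φ => φ x) h2⟩

end IsReversible

end WeightedGraph

/-! ### Words in forward arrows -/

namespace WeightedGraph

variable {V : Type u} {E : Type v} {G : WeightedGraph V E} {K : Type k} [Field K] {sp : Set E}

variable (G) in
/-- The edges to be reversed: the edges that are weighted or start at a vertex reachable from the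
range of a weighted edge, except for the weighted edges of type B. -/
def revEdges : Set E := G.tailEdges \ G.typeB

theorem LocallyFinite.not_inTail_source_of_typeB (hG : G.LocallyFinite K) {e : E}
    (he : e ∈ G.typeB) : ¬G.InTail (G.s e) := fun h =>
  he.2 (Set.ext fun _ => ⟨fun hf => (hG.eq_of_inTail h (Eq.symm hf)).symm,
    fun hf => congrArg G.s hf⟩)

theorem LocallyFinite.not_inTail_source (hG : G.LocallyFinite K) {e : E}
    (he : e ∉ G.revEdges) : ¬G.InTail (G.s e) := fun h =>
  he ⟨.inr h, fun h' => hG.not_inTail_source_of_typeB h' h⟩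

theorem notMem_revEdges_of_typeB {e : E} (he : e ∈ G.typeB) : e ∉ G.revEdges := fun h => h.2 he

theorem mem_tailEdges_of_typeB {e : E} (he : e ∈ G.typeB) : e ∈ G.tailEdges := .inl he.1

theorem mem_typeB_of_weighted {e : E} (he : e ∉ G.revEdges) (hw : 1 < G.w e) : e ∈ G.typeB := by
  by_contra h
  exact he ⟨.inl hw, h⟩

theorem w_eq_one {e : E} (he : e ∉ G.revEdges) (hB : e ∉ G.typeB) : G.w e = 1 := by
  by_contra h
  exact hB (mem_typeB_of_weighted he (lt_of_le_of_ne (G.one_le_w e) (Ne.symm h)))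

theorem LocallyFinite.sole_of_mem_revEdges (hG : G.LocallyFinite K) {h : E}
    (hh : h ∈ G.revEdges) {f : E} (hf : G.s f = G.s h) : f = h := by
  rcases hh.1 with hw | ht
  · have : {f | G.s f = G.s h} = {h} := by
      by_contra hne
      exact hh.2 ⟨hw, hne⟩
    exact this.subset hf
  · exact (hG.eq_of_inTail ht hf.symm).symm

theorem LocallyFinite.isReversible (hG : G.LocallyFinite K) : G.IsReversible G.revEdges where
  sole _ hh _ hf := hG.sole_of_mem_revEdges hh hf
  injOn := hG.range_injOn.mono Set.sdiff_subset
  mem_of_source h hh f hf := by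
    by_contra hfR
    exact hG.not_inTail_source hfR (hf ▸ inTail_range hh.1)

/-- The other edges at `s(e)` have weight one and do not contribute to `∑ f_i f_j^*` unless both
indices are the first one. -/
theorem LocallyFinite.re_mul_gh_typeB (hG : G.LocallyFinite K) {e : E} (he : e ∈ G.typeB)
    {i j : ℕ} (hi : i < G.w e) (hj : j < G.w e) (hij : 1 ≤ i ∨ 1 ≤ j) :
    G.re K e i * G.gh K e j = if i = j then G.vtx K (G.s e) else 0 := by
  classical
  have := G.sum_re_mul_gh K (G.s e) i j (hi.trans_le (G.w_le_vw e)) (hj.trans_le (G.w_le_vw e))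
  rw [Finset.sum_eq_single e] at this
  · exact this
  · intro f hf hfe
    rw [mem_out] at hf
    have hfw : G.w f ≤ 1 := by
      by_contra hfw
      exact hfe (hG.eq_of_weighted (not_le.1 hfw) he.1 hf)
    rcases hij with h | h
    · rw [G.re_zero K f i (hfw.trans h), zero_mul]
    · rw [G.gh_zero K f j (hfw.trans h), mul_zero]
  · exact fun h => absurd (G.mem_out.2 rfl) h

variable (G)

/-- The positive arrows: the unweighted edges that are not reversed, the reversals of edges, and
the ghost edges `e_i^*` with `i ≠ 1` (nonzero in the numbering from `0`) for weighted edges `e` of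
type B. -/
def IsPos : Arrow E → Prop
  | .real f i => f ∉ G.revEdges ∧ G.w f = 1 ∧ i = 0
  | .ghost h i => i < G.w h ∧ (h ∈ G.revEdges ∨ h ∈ G.typeB ∧ 1 ≤ i)

/-- The terminal arrows: the real edges `e_1` for weighted edges `e` of type B. -/
def IsTerm : Arrow E → Prop
  | .real e i => e ∈ G.typeB ∧ i = 0
  | .ghost _ _ => False

/-- The forward arrows: positive or terminal. -/
def IsFwd (a : Arrow E) : Prop := G.IsPos a ∨ G.IsTerm a

open Classical in
/-- The degree of an arrow in the standard grading of the algebra of the reversed graph. -/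
noncomputable def revDeg : Arrow E → (ℕ →₀ ℤ)
  | .real e i => if e ∈ G.revEdges then -Finsupp.single 0 1 else Finsupp.single i 1
  | .ghost e i => if e ∈ G.revEdges then Finsupp.single 0 1 else -Finsupp.single i 1

theorem revDeg_star (a : Arrow E) : G.revDeg a.star = -G.revDeg a := by
  cases a <;> simp only [Arrow.star, revDeg] <;> split_ifs <;> simp

theorem wordDeg_revDeg_starRev (l : List (Arrow E)) :
    wordDeg G.revDeg (starRev l) = -wordDeg G.revDeg l := by
  induction l with
  | nil => simp [starRev]
  | cons a l ih =>
    have : starRev (a :: l) = starRev l ++ [a.star] := by simp [starRev]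
    rw [this, wordDeg_append, ih]
    simp [revDeg_star]

variable {G}

theorem IsFwd.valid {a : Arrow E} (ha : G.IsFwd a) : G.Valid a := by
  cases a with
  | real f i =>
    rcases ha with ⟨-, -, rfl⟩ | ⟨-, rfl⟩ <;> exact G.w_pos f
  | ghost h i =>
    rcases ha with ⟨h1, -⟩ | h1
    · exact h1
    · exact h1.elim

theorem isFwd_or_star {a : Arrow E} (ha : G.Valid a) : G.IsFwd a ∨ G.IsFwd a.star := by
  have key : ∀ e i, i < G.w e → G.IsFwd (.real e i) ∨ G.IsFwd (.ghost e i) := by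
    intro e i hi
    by_cases heR : e ∈ G.revEdges
    · exact .inr (.inl ⟨hi, .inl heR⟩)
    by_cases heB : e ∈ G.typeB
    · rcases Nat.eq_zero_or_pos i with h0 | h0
      · exact .inl (.inr ⟨heB, h0⟩)
      · exact .inr (.inl ⟨hi, .inr ⟨heB, h0⟩⟩)
    · have := w_eq_one heR heB
      exact .inl (.inl ⟨heR, this, by omega⟩)
  cases a with
  | real e i => exact key e i ha
  | ghost e i => exact (key e i ha).symm

theorem IsFwd.index_eq_zero {f : E} {i : ℕ} (h : G.IsFwd (.real f i)) : i = 0 := by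
  rcases h with ⟨-, -, h⟩ | ⟨-, h⟩ <;> exact h

theorem IsFwd.notMem_revEdges {f : E} {i : ℕ} (h : G.IsFwd (.real f i)) : f ∉ G.revEdges := by
  rcases h with ⟨h, -, -⟩ | ⟨h, -⟩
  · exact h
  · exact notMem_revEdges_of_typeB h

theorem IsFwd.mem_tailEdges {h : E} {i : ℕ} (hh : G.IsFwd (.ghost h i)) : h ∈ G.tailEdges := by
  rcases hh with ⟨-, h | ⟨h, -⟩⟩ | h
  · exact h.1
  · exact mem_tailEdges_of_typeB h
  · exact h.elim

theorem isFwd_real {f : E} (hf : f ∉ G.revEdges) : G.IsFwd (.real f 0) := by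
  by_cases hB : f ∈ G.typeB
  · exact .inr ⟨hB, rfl⟩
  · exact .inl ⟨hf, w_eq_one hf hB, rfl⟩

/-- Real and ghost forward arrows have different sources. -/
theorem LocallyFinite.source_ne_of_isFwd (hG : G.LocallyFinite K) {f h : E} {i j : ℕ}
    (hf : G.IsFwd (.real f i)) (hh : G.IsFwd (.ghost h j)) : G.s f ≠ G.r h := fun he =>
  hG.not_inTail_source hf.notMem_revEdges (he ▸ inTail_range hh.mem_tailEdges)

theorem val_mul_vtx (a : Arrow E) : G.val K a * G.vtx K (G.tgt a) = G.val K a := by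
  cases a
  · exact G.re_mul_range K _ _
  · exact G.gh_mul_source K _ _

theorem vtx_mul_val (a : Arrow E) : G.vtx K (G.src a) * G.val K a = G.val K a := by
  cases a
  · exact G.source_mul_re K _ _
  · exact G.range_mul_gh K _ _

theorem val_mul_val_of_ne {a b : Arrow E} (h : G.tgt a ≠ G.src b) :
    G.val K a * G.val K b = 0 := by
  rw [← val_mul_vtx a, ← vtx_mul_val b, mul_assoc, ← mul_assoc (G.vtx K _), vtx_mul_vtx, if_neg h,
    zero_mul, mul_zero]

theorem val_eq_zero {a : Arrow E} (h : ¬G.Valid a) : G.val K a = 0 := by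
  cases a with
  | real e i => exact G.re_zero K e i (not_lt.1 h)
  | ghost e i => exact G.gh_zero K e i (not_lt.1 h)

theorem vtx_mul_word (x : V) (l : List (Arrow E)) (y : V) :
    G.vtx K x * G.word K l y = G.word K l y ∨ G.vtx K x * G.word K l y = 0 := by
  cases l with
  | nil =>
    rw [word, vtx_mul_vtx]
    split_ifs with h
    · rw [h]; exact .inl rfl
    · exact .inr rfl
  | cons a l =>
    rw [word, ← mul_assoc]
    by_cases h : x = G.src a
    · rw [h, vtx_mul_val]; exact .inl rfl
    · rw [← vtx_mul_val a, ← mul_assoc, vtx_mul_vtx, if_neg h, zero_mul, zero_mul]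
      exact .inr rfl

/-- A terminal arrow annihilates forward arrows from the left. -/
theorem LocallyFinite.term_mul_fwd (hG : G.LocallyFinite K) {a b : Arrow E} (ha : G.IsTerm a)
    (hb : G.IsFwd b) : G.val K a * G.val K b = 0 := by
  by_cases hab : G.tgt a = G.src b
  swap
  · exact val_mul_val_of_ne hab
  cases a with
  | ghost e i => exact ha.elim
  | real e i =>
    obtain ⟨he, rfl⟩ := ha
    cases b with
    | real f j =>
      have hab' : G.r e = G.s f := hab
      exact absurd (hab' ▸ inTail_range (mem_tailEdges_of_typeB he))
        (hG.not_inTail_source hb.notMem_revEdges)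
    | ghost h j =>
      obtain rfl := hG.range_injOn (mem_tailEdges_of_typeB he) hb.mem_tailEdges hab
      rcases hb with ⟨hj, h | ⟨-, h⟩⟩ | h
      · exact absurd he h.2
      · have := hG.re_mul_gh_typeB he (G.w_pos e) hj (.inr h)
        rwa [if_neg (by omega)] at this
      · exact h.elim

/-- The adjoint version of `term_mul_fwd`. -/
theorem LocallyFinite.star_fwd_mul_star_term (hG : G.LocallyFinite K) {a b : Arrow E}
    (ha : G.IsTerm a) (hb : G.IsFwd b) : G.val K b.star * G.val K a.star = 0 := by
  by_cases hab : G.tgt b.star = G.src a.star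
  swap
  · exact val_mul_val_of_ne hab
  cases a with
  | ghost e i => exact ha.elim
  | real e i =>
    obtain ⟨he, rfl⟩ := ha
    cases b with
    | real f j =>
      have hab' : G.s f = G.r e := hab
      exact absurd (hab'.symm ▸ inTail_range (mem_tailEdges_of_typeB he))
        (hG.not_inTail_source hb.notMem_revEdges)
    | ghost h j =>
      obtain rfl := hG.range_injOn (mem_tailEdges_of_typeB he) hb.mem_tailEdges hab.symm
      rcases hb with ⟨hj, h | ⟨-, h⟩⟩ | h
      · exact absurd he h.2
      · have := hG.re_mul_gh_typeB he hj (G.w_pos e) (.inl h)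
        rwa [if_neg (by omega)] at this
      · exact h.elim

/-- The products `b^* c` of forward arrows `b`, `c`. -/
theorem LocallyFinite.star_mul_fwd (hG : G.LocallyFinite K) {b c : Arrow E} (hb : G.IsFwd b)
    (hc : G.IsFwd c) :
    G.val K b.star * G.val K c = 0 ∨
    (b = c ∧ ∃ x, G.val K b.star * G.val K c = G.vtx K x) ∨
    ∃ e ∈ G.typeB, b = .real e 0 ∧ c = .real e 0 ∧ G.val K b.star * G.val K c =
      G.vtx K (G.r e) - ∑ i ∈ Finset.Ico 1 (G.vw (G.s e)), G.gh K e i * G.re K e i := by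
  classical
  by_cases hbc : G.tgt b.star = G.src c
  swap
  · exact .inl (val_mul_val_of_ne hbc)
  cases b with
  | real f i =>
    cases c with
    | ghost h j => exact absurd hbc (hG.source_ne_of_isFwd hb hc)
    | real g j =>
      have hfg : G.s f = G.s g := hbc
      obtain rfl := hb.index_eq_zero
      obtain rfl := hc.index_eq_zero
      have hpos : 0 < G.vw (G.s f) := (G.w_pos f).trans_le (G.w_le_vw f)
      have hsum := G.sum_gh_mul_re K f g hfg
      rw [Finset.range_eq_Ico, Finset.sum_eq_sum_Ico_succ_bot hpos, zero_add] at hsum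
      by_cases hB : f ∈ G.typeB ∧ g ∈ G.typeB
      · obtain rfl := hG.eq_of_weighted hB.1.1 hB.2.1 hfg
        rw [if_pos rfl] at hsum
        exact .inr (.inr ⟨f, hB.1, rfl, rfl, eq_sub_of_add_eq hsum⟩)
      · rw [Finset.sum_eq_zero, add_zero] at hsum
        · split_ifs at hsum with h
          · exact .inr (.inl ⟨h ▸ rfl, _, hsum⟩)
          · exact .inl hsum
        · intro m hm
          rw [Finset.mem_Ico] at hm
          by_cases hf : f ∈ G.typeB
          · have := w_eq_one hc.notMem_revEdges (fun hg => hB ⟨hf, hg⟩)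
            rw [G.re_zero K g m (by omega), mul_zero]
          · have := w_eq_one hb.notMem_revEdges hf
            rw [G.gh_zero K f m (by omega), zero_mul]
  | ghost h i =>
    cases c with
    | real g j => exact absurd hbc.symm (hG.source_ne_of_isFwd hc hb)
    | ghost h' j =>
      obtain rfl := hG.range_injOn hb.mem_tailEdges hc.mem_tailEdges hbc
      have key : G.re K h i * G.gh K h j = if i = j then G.vtx K (G.s h) else 0 := by
        rcases hb with ⟨hi, hR | ⟨hB, h1⟩⟩ | h0
        · exact re_mul_gh_of_sole (fun f hf => hG.sole_of_mem_revEdges hR hf) hi hc.valid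
        · exact hG.re_mul_gh_typeB hB hi hc.valid (.inl h1)
        · exact h0.elim
      split_ifs at key with hij
      · exact .inr (.inl ⟨hij ▸ rfl, _, key⟩)
      · exact .inl key

variable (G K) in
/-- The span of the words `p q^*` of degree `g`, with `p` and `q` composed of forward arrows; the
degree is that of the reversed graph. -/
noncomputable def fwdSpan (g : ℕ →₀ ℤ) : Submodule K (G.WLPA K) :=
  Submodule.span K {x | ∃ p m y, (∀ a ∈ p, G.IsFwd a) ∧ (∀ a ∈ m, G.IsFwd a.star) ∧
    wordDeg G.revDeg (p ++ m) = g ∧ x = G.word K (p ++ m) y}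

theorem fwd_mul_mem_fwdSpan {a : Arrow E} (ha : G.IsFwd a) {g : ℕ →₀ ℤ} {x : G.WLPA K}
    (hx : x ∈ G.fwdSpan K g) : G.val K a * x ∈ G.fwdSpan K (G.revDeg a + g) := by
  induction hx using Submodule.span_induction with
  | zero => rw [mul_zero]; exact zero_mem _
  | add x y _ _ hx hy => rw [mul_add]; exact add_mem hx hy
  | smul c x _ hx => rw [mul_smul_comm]; exact Submodule.smul_mem _ c hx
  | mem x hx =>
    obtain ⟨p, m, y, hp, hm, rfl, rfl⟩ := hx
    refine Submodule.subset_span ⟨a :: p, m, y, ?_, hm, ?_, rfl⟩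
    · rintro b hb
      rcases List.mem_cons.1 hb with rfl | hb
      · exact ha
      · exact hp b hb
    · rw [List.cons_append, wordDeg_cons]

theorem vtx_mul_mem_fwdSpan (z : V) {g : ℕ →₀ ℤ} {x : G.WLPA K}
    (hx : x ∈ G.fwdSpan K g) : G.vtx K z * x ∈ G.fwdSpan K g := by
  induction hx using Submodule.span_induction with
  | zero => rw [mul_zero]; exact zero_mem _
  | add x y _ _ hx hy => rw [mul_add]; exact add_mem hx hy
  | smul c x _ hx => rw [mul_smul_comm]; exact Submodule.smul_mem _ c hx
  | mem x hx =>
    have hx' := hx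
    obtain ⟨p, m, y, hp, hm, rfl, rfl⟩ := hx
    rcases vtx_mul_word (K := K) z (p ++ m) y with h | h
    · rw [h]; exact Submodule.subset_span hx'
    · rw [h]; exact zero_mem _

/-- The span of the words `p q^*` absorbs adjoint forward arrows from the left; the proof is by
induction on the length of `p`. -/
theorem LocallyFinite.star_mul_word_mem (hG : G.LocallyFinite K) {m : List (Arrow E)} {y : V}
    (hm : ∀ a ∈ m, G.IsFwd a.star) (p : List (Arrow E)) (hp : ∀ a ∈ p, G.IsFwd a) :
    ∀ b, G.IsFwd b → G.val K b.star * G.word K (p ++ m) y ∈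
      G.fwdSpan K (G.revDeg b.star + wordDeg G.revDeg (p ++ m)) := by
  induction p with
  | nil =>
    intro b hb
    refine Submodule.subset_span ⟨[], b.star :: m, y, by simp, ?_, by simp, rfl⟩
    rintro a ha
    rcases List.mem_cons.1 ha with rfl | ha
    · rwa [Arrow.star_star]
    · exact hm a ha
  | cons c p ih =>
    intro b hb
    have hc : G.IsFwd c := hp c (by simp)
    have hp' : ∀ a ∈ p, G.IsFwd a := fun a ha => hp a (List.mem_cons_of_mem _ ha)
    have hW : G.word K (p ++ m) y ∈ G.fwdSpan K (wordDeg G.revDeg (p ++ m)) :=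
      Submodule.subset_span ⟨p, m, y, hp', hm, rfl, rfl⟩
    rw [List.cons_append, word, ← mul_assoc, wordDeg_cons]
    rcases hG.star_mul_fwd hb hc with h | ⟨rfl, x, h⟩ | ⟨e, he, rfl, rfl, h⟩
    · rw [h, zero_mul]
      exact zero_mem _
    · rw [h, revDeg_star, neg_add_cancel_left]
      exact vtx_mul_mem_fwdSpan x hW
    · rw [h, revDeg_star, neg_add_cancel_left, sub_mul, Finset.sum_mul]
      refine sub_mem (vtx_mul_mem_fwdSpan _ hW) (sum_mem fun i hi => ?_)
      rw [Finset.mem_Ico] at hi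
      by_cases hiw : i < G.w e
      · have hfwd : G.IsFwd (.ghost e i) := .inl ⟨hiw, .inr ⟨he, hi.1⟩⟩
        have := fwd_mul_mem_fwdSpan hfwd (ih hp' (.ghost e i) hfwd)
        rwa [revDeg_star, add_neg_cancel_left, ← mul_assoc] at this
      · rw [G.gh_zero K e i (not_lt.1 hiw), zero_mul, zero_mul]
        exact zero_mem _

theorem LocallyFinite.val_mul_mem_fwdSpan (hG : G.LocallyFinite K) (a : Arrow E) {g : ℕ →₀ ℤ}
    {x : G.WLPA K} (hx : x ∈ G.fwdSpan K g) : G.val K a * x ∈ G.fwdSpan K (G.revDeg a + g) := by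
  by_cases hv : G.Valid a
  swap
  · rw [val_eq_zero hv, zero_mul]
    exact zero_mem _
  rcases isFwd_or_star hv with ha | ha
  · exact fwd_mul_mem_fwdSpan ha hx
  induction hx using Submodule.span_induction with
  | zero => rw [mul_zero]; exact zero_mem _
  | add x y _ _ hx hy => rw [mul_add]; exact add_mem hx hy
  | smul c x _ hx => rw [mul_smul_comm]; exact Submodule.smul_mem _ c hx
  | mem x hx =>
    obtain ⟨p, m, y, hp, hm, rfl, rfl⟩ := hx
    have := hG.star_mul_word_mem (y := y) hm p hp _ ha
    rwa [Arrow.star_star] at this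

theorem vtx_mem_fwdSpan (x : V) : G.vtx K x ∈ G.fwdSpan K 0 :=
  Submodule.subset_span ⟨[], [], x, by simp, by simp, rfl, rfl⟩

theorem LocallyFinite.val_mem_fwdSpan (hG : G.LocallyFinite K) (a : Arrow E) :
    G.val K a ∈ G.fwdSpan K (G.revDeg a) := by
  have := hG.val_mul_mem_fwdSpan a (vtx_mem_fwdSpan (G.tgt a))
  rwa [val_mul_vtx, add_zero] at this

end WeightedGraph

/-! ### Cycles of forward arrows and local finiteness of the reversed graph -/

namespace WeightedGraph

variable {V : Type u} {E : Type v} {G : WeightedGraph V E} {K : Type k} [Field K] {sp : Set E}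

variable (G) in
/-- There is a positive arrow from `x` to `y`. -/
def PosStep (x y : V) : Prop := ∃ a, G.IsPos a ∧ G.src a = x ∧ G.tgt a = y

variable (G) in
/-- The vertex `x` lies on a cycle of positive arrows. -/
def Recurrent (x : V) : Prop := Relation.TransGen G.PosStep x x

/-- Paths of forward arrows are normal words. -/
theorem LocallyFinite.fits_of_isPos (hG : G.LocallyFinite K) {a b : Arrow E} (ha : G.IsPos a)
    (hb : G.IsFwd b) (hab : G.tgt a = G.src b) : G.Fits sp a b := by
  cases a with
  | real f i =>
    cases b with
    | real g j => exact hab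
    | ghost h j =>
      refine ⟨hab, ?_⟩
      rintro ⟨rfl, -⟩
      obtain ⟨h1, h2, -⟩ := ha
      exact hb.mem_tailEdges.elim (fun h => by omega) fun h => hG.not_inTail_source h1 h
  | ghost h i =>
    cases b with
    | ghost g j => exact hab
    | real f j =>
      have hab' : G.s h = G.s f := hab
      refine ⟨hab', ?_⟩
      rintro ⟨rfl, -⟩
      rcases ha with ⟨-, hR | ⟨-, h0⟩⟩
      · exact hb.notMem_revEdges (hG.sole_of_mem_revEdges hR hab'.symm ▸ hR)
      · omega

theorem LocallyFinite.exists_normalList_of_transGen (hG : G.LocallyFinite K) {x y : V}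
    (h : Relation.TransGen G.PosStep x y) : ∃ a l, G.NormalList sp (a :: l) ∧
      (∀ b ∈ a :: l, G.IsPos b) ∧ G.src a = x ∧ ∀ b ∈ (a :: l).getLast?, G.tgt b = y := by
  induction h using Relation.TransGen.head_induction_on with
  | single h =>
    obtain ⟨a, ha, hs, ht⟩ := h
    refine ⟨a, [], ⟨?_, by simp⟩, by simpa using ha, hs, ?_⟩
    · simpa using IsFwd.valid (.inl ha)
    · rintro _ ⟨⟩
      exact ht
  | head h _ ih =>
    obtain ⟨a, ha, hs, ht⟩ := h
    obtain ⟨b, l, hl, hpos, hbs, hbt⟩ := ih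
    have hb : G.IsFwd b := .inl (hpos b (by simp))
    refine ⟨a, b :: l, ⟨?_, ?_⟩, ?_, hs, ?_⟩
    · intro c hc
      rcases List.mem_cons.1 hc with rfl | hc
      · exact IsFwd.valid (.inl ha)
      · exact hl.1 c hc
    · exact List.isChain_cons_cons.2 ⟨hG.fits_of_isPos ha hb (ht.trans hbs.symm), hl.2⟩
    · intro c hc
      rcases List.mem_cons.1 hc with rfl | hc
      · exact ha
      · exact hpos c hc
    · rwa [List.getLast?_cons_cons]

/-- If two forward arrows start at `x`, then `d d^*` is a normal word for some forward arrow `d`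
that starts at `x`. -/
theorem LocallyFinite.exists_fits_star (hG : G.LocallyFinite K) (hsp : G.IsSpecial sp)
    {a b : Arrow E} (ha : G.IsFwd a) (hb : G.IsFwd b) (hab : G.src a = G.src b) (hne : a ≠ b) :
    ∃ d, G.IsFwd d ∧ G.src d = G.src a ∧ G.Fits sp d d.star := by
  cases a with
  | real f i =>
    cases b with
    | ghost h j => exact absurd hab (hG.source_ne_of_isFwd ha hb)
    | real g j =>
      have hi := ha.index_eq_zero
      have hj := hb.index_eq_zero
      have hfg : G.s f = G.s g := hab
      by_cases hf : f ∈ sp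
      · refine ⟨.real g j, hb, hfg.symm, rfl, fun h => hne ?_⟩
        rw [hsp.eq_of_mem f hf g h.2 hfg, hi, hj]
      · exact ⟨.real f i, ha, rfl, rfl, fun h => hf h.2⟩
  | ghost h i =>
    cases b with
    | real g j => exact absurd hab.symm (hG.source_ne_of_isFwd hb ha)
    | ghost h' j =>
      have hr : G.r h = G.r h' := hab
      obtain rfl := hG.range_injOn ha.mem_tailEdges hb.mem_tailEdges hr
      by_cases hi : i = 0
      · refine ⟨.ghost h j, hb, rfl, rfl, fun h' => hne ?_⟩
        rw [hi, h'.1]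
      · exact ⟨.ghost h i, ha, rfl, rfl, fun h' => hi h'.1⟩

/-- A cycle of positive arrows has no exit: otherwise the words `c^n d d^* (c^*)^n`, for the cycle
`c` and a forward arrow `d`, are infinitely many normal words of degree zero. -/
theorem LocallyFinite.eq_of_recurrent (hG : G.LocallyFinite K) {a b : Arrow E}
    (hx : G.Recurrent (G.src a)) (ha : G.IsFwd a) (hb : G.IsFwd b) (hab : G.src a = G.src b) :
    a = b := by
  obtain ⟨sp, hsp⟩ := G.exists_isSpecial
  by_contra hne
  obtain ⟨d, hd, hds, hdd⟩ := hG.exists_fits_star hsp ha hb hab hne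
  obtain ⟨c, l, hl, hpos, hcs, hct⟩ := hG.exists_normalList_of_transGen (sp := sp) hx
  let f : ℕ → List (Arrow E) := fun n => n.rec [d] fun _ w => (c :: l) ++ w
  have hf : ∀ n, f (n + 1) = (c :: l) ++ f n := fun n => rfl
  have hlast : ∀ n, (f n).getLast? = some d := by
    intro n
    induction n with
    | zero => rfl
    | succ n ih => rw [hf, List.getLast?_append, ih]; rfl
  have hhead : ∀ n, ∀ e ∈ (f n).head?, G.IsFwd e ∧ G.src e = G.src a := by
    intro n
    cases n with
    | zero =>
      rintro _ ⟨⟩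
      exact ⟨hd, hds⟩
    | succ n =>
      rintro _ ⟨⟩
      exact ⟨.inl (hpos c (by simp)), hcs⟩
  have hnorm : ∀ n, G.NormalList sp (f n) := by
    intro n
    induction n with
    | zero => exact ⟨by simpa [f] using hd.valid, by simp [f]⟩
    | succ n ih =>
      rw [hf]
      refine hl.append ih fun e he e' he' => ?_
      exact hG.fits_of_isPos (hpos e (List.mem_of_getLast? he)) (hhead n e' he').1
        ((hct e he).trans (hhead n e' he').2.symm)
  have hloop : ∀ n, ∃ e, G.IsLoop sp e (f n ++ starRev (f n)) := by
    intro n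
    obtain ⟨e, w, hw⟩ : ∃ e w, f n = e :: w := by
      cases n with
      | zero => exact ⟨_, _, rfl⟩
      | succ n => exact ⟨_, _, rfl⟩
    have h1 := hnorm n
    have h2 := hlast n
    rw [hw] at h1 h2 ⊢
    refine ⟨e, h1.isLoop ?_⟩
    rw [h2]
    rintro _ ⟨⟩
    exact hdd
  choose e he using hloop
  refine hG.false_of_strictMono hsp (f := fun n => f n ++ starRev (f n)) ?_
    (fun n => (he n).normal) (fun n => (he n).deg)
  refine strictMono_nat_of_lt_succ fun n => ?_
  simp only [hf, List.length_append, starRev, List.length_reverse, List.length_map,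
    List.length_cons]
  omega

theorem Recurrent.exists_isPos {x : V} (hx : G.Recurrent x) : ∃ a, G.IsPos a ∧ G.src a = x := by
  obtain ⟨y, ⟨a, ha, hs, -⟩, -⟩ := Relation.TransGen.head'_iff.1 hx
  exact ⟨a, ha, hs⟩

theorem LocallyFinite.isPos_of_recurrent (hG : G.LocallyFinite K) {a : Arrow E}
    (hx : G.Recurrent (G.src a)) (ha : G.IsFwd a) : G.IsPos a := by
  obtain ⟨b, hb, hs⟩ := hx.exists_isPos
  rwa [hG.eq_of_recurrent hx ha (.inl hb) hs.symm]

theorem LocallyFinite.recurrent_tgt (hG : G.LocallyFinite K) {a : Arrow E}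
    (hx : G.Recurrent (G.src a)) (ha : G.IsFwd a) : G.Recurrent (G.tgt a) := by
  obtain ⟨y, ⟨b, hb, hs, rfl⟩, h⟩ := Relation.TransGen.head'_iff.1 hx
  obtain rfl := hG.eq_of_recurrent hx ha (.inl hb) hs.symm
  exact Relation.TransGen.tail' h ⟨a, hb, rfl, rfl⟩

/-- On a cycle of positive arrows there are no ghost edges of weighted edges `e` of type B, since
`e_1` is an exit at `s(e)`. -/
theorem LocallyFinite.mem_revEdges_of_recurrent (hG : G.LocallyFinite K) {h : E} {i : ℕ}
    (hx : G.Recurrent (G.r h)) (hh : G.IsFwd (.ghost h i)) : h ∈ G.revEdges := by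
  by_contra hR
  have ht : G.Recurrent (G.s h) := hG.recurrent_tgt (a := .ghost h i) hx hh
  have hp := hG.isPos_of_recurrent (a := .real h 0) ht (isFwd_real hR)
  exact hh.mem_tailEdges.elim (fun h1 => absurd hp.2.1 h1.ne')
    fun h1 => hG.not_inTail_source hR h1

theorem LocallyFinite.revDeg_of_recurrent (hG : G.LocallyFinite K) {a : Arrow E}
    (hx : G.Recurrent (G.src a)) (ha : G.IsFwd a) : G.revDeg a = Finsupp.single 0 1 := by
  cases a with
  | real f i =>
    obtain rfl := ha.index_eq_zero
    exact if_neg ha.notMem_revEdges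
  | ghost h i => exact if_pos (hG.mem_revEdges_of_recurrent hx ha)

/-- An arrow on a cycle is the only summand in the relation at its source. -/
theorem LocallyFinite.val_mul_star_of_recurrent (hG : G.LocallyFinite K) {a : Arrow E}
    (hx : G.Recurrent (G.src a)) (ha : G.IsFwd a) :
    G.val K a * G.val K a.star = G.vtx K (G.src a) := by
  cases a with
  | real f i =>
    obtain rfl := ha.index_eq_zero
    have hs : ∀ g, G.s g = G.s f → g = f := by
      intro g hg
      have hgR : g ∉ G.revEdges := fun hgR =>
        ha.notMem_revEdges (hG.sole_of_mem_revEdges hgR hg.symm ▸ hgR)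
      have := hG.eq_of_recurrent hx ha (isFwd_real hgR) hg.symm
      injection this with h1 _
      exact h1.symm
    exact (re_mul_gh_of_sole hs (G.w_pos f) (G.w_pos f)).trans (if_pos rfl)
  | ghost h i =>
    have hR := hG.mem_revEdges_of_recurrent hx ha
    have hi : ∀ j, j < G.w h → i = j := by
      intro j hj
      have := hG.eq_of_recurrent hx ha (b := .ghost h j) (.inl ⟨hj, .inl hR⟩) rfl
      injection this
    have hw : G.w h = 1 := by
      by_contra hw
      have h1 : 1 < G.w h := lt_of_le_of_ne (G.one_le_w h) (Ne.symm hw)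
      have := (hi 0 (G.w_pos h)).symm.trans (hi 1 h1)
      omega
    obtain rfl := hi 0 (G.w_pos h)
    have := sum_gh_mul_re_of_sole (K := K) (fun f => hG.sole_of_mem_revEdges hR (f := f))
    rwa [hw, Finset.sum_range_one] at this

/-- A positive arrow on a cycle is determined by its range: the successor map on the finite set of
recurrent vertices is surjective, hence injective. -/
theorem LocallyFinite.eq_of_tgt_eq (hG : G.LocallyFinite K) {a b : Arrow E}
    (hxa : G.Recurrent (G.src a)) (ha : G.IsFwd a) (hxb : G.Recurrent (G.src b))
    (hb : G.IsFwd b) (hab : G.tgt a = G.tgt b) : a = b := by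
  obtain ⟨sp, hsp⟩ := G.exists_isSpecial
  have := hG.finite_vertices hsp
  choose f hf hfs using fun x : {x // G.Recurrent x} => x.2.exists_isPos
  have hrec : ∀ x, G.Recurrent (G.src (f x)) := fun x => by rw [hfs]; exact x.2
  let next : {x // G.Recurrent x} → {x // G.Recurrent x} := fun x =>
    ⟨G.tgt (f x), hG.recurrent_tgt (hrec x) (.inl (hf x))⟩
  have huniq : ∀ c, (hc : G.Recurrent (G.src c)) → G.IsFwd c → f ⟨G.src c, hc⟩ = c :=
    fun c hc hcf => hG.eq_of_recurrent (hrec _) (.inl (hf _)) hcf (hfs _)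
  have hsurj : Function.Surjective next := by
    rintro ⟨y, hy⟩
    obtain ⟨x, hyx, c, hc, rfl, rfl⟩ := Relation.TransGen.tail'_iff.1 hy
    have hcx : G.Recurrent (G.src c) := Relation.TransGen.head' ⟨c, hc, rfl, rfl⟩ hyx
    exact ⟨⟨G.src c, hcx⟩, Subtype.ext (congrArg G.tgt (huniq c hcx (.inl hc)))⟩
  have hinj := Finite.injective_iff_surjective.2 hsurj
  have h1 : next ⟨G.src a, hxa⟩ = next ⟨G.src b, hxb⟩ := by
    refine Subtype.ext ?_
    change G.tgt (f _) = G.tgt (f _)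
    rw [huniq a hxa ha, huniq b hxb hb, hab]
  exact hG.eq_of_recurrent hxa ha hb (congrArg Subtype.val (hinj h1))

variable (G) in
/-- `p` is a path of forward arrows in which only the last arrow may be terminal. -/
structure IsFwdPath (p : List (Arrow E)) : Prop where
  fwd : ∀ a ∈ p, G.IsFwd a
  chain : p.IsChain fun a b => G.tgt a = G.src b ∧ ¬G.IsTerm a

theorem IsFwdPath.tail {a : Arrow E} {p : List (Arrow E)} (h : G.IsFwdPath (a :: p)) :
    G.IsFwdPath p :=
  ⟨fun b hb => h.fwd b (List.mem_cons_of_mem _ hb), h.chain.tail⟩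

theorem IsFwdPath.posStep {a b : Arrow E} {p : List (Arrow E)} (h : G.IsFwdPath (a :: b :: p)) :
    G.PosStep (G.src a) (G.src b) := by
  obtain ⟨h1, h2⟩ := (List.isChain_cons_cons.1 h.chain).1
  exact ⟨a, (h.fwd a (by simp)).resolve_right h2, rfl, h1⟩

theorem IsFwdPath.transGen {a : Arrow E} {p : List (Arrow E)} (h : G.IsFwdPath (a :: p)) :
    ∀ b ∈ p, Relation.TransGen G.PosStep (G.src a) (G.src b) := by
  induction p generalizing a with
  | nil => simp
  | cons c p ih =>
    intro b hb
    rcases List.mem_cons.1 hb with rfl | hb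
    · exact .single h.posStep
    · exact .head h.posStep (ih h.tail b hb)

/-- A path of forward arrows without recurrent sources does not visit a source twice. -/
theorem IsFwdPath.nodup {p : List (Arrow E)} (h : G.IsFwdPath p)
    (hp : ∀ a ∈ p, ¬G.Recurrent (G.src a)) : (p.map G.src).Nodup := by
  induction p with
  | nil => simp
  | cons a p ih =>
    rw [List.map_cons, List.nodup_cons]
    refine ⟨fun ha => ?_, ih h.tail fun b hb => hp b (List.mem_cons_of_mem _ hb)⟩
    obtain ⟨b, hb, hba⟩ := List.mem_map.1 ha
    have := h.transGen b hb
    rw [hba] at this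
    exact hp a (by simp) this

/-- A path of forward arrows stays on a cycle as soon as it has met one. -/
theorem LocallyFinite.exists_append (hG : G.LocallyFinite K) {p : List (Arrow E)}
    (h : G.IsFwdPath p) : ∃ p₁ t, p = p₁ ++ t ∧ G.IsFwdPath p₁ ∧
      (∀ a ∈ p₁, ¬G.Recurrent (G.src a)) ∧ ∀ a ∈ t, G.Recurrent (G.src a) ∧ G.IsFwd a := by
  induction p with
  | nil => exact ⟨[], [], rfl, ⟨by simp, by simp⟩, by simp, by simp⟩
  | cons a p ih =>
    by_cases ha : G.Recurrent (G.src a)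
    · refine ⟨[], a :: p, rfl, ⟨by simp, by simp⟩, by simp, fun b hb => ⟨?_, h.fwd b hb⟩⟩
      clear ih
      induction p generalizing a with
      | nil =>
        rw [List.mem_singleton] at hb
        rwa [hb]
      | cons c p ih =>
        rcases List.mem_cons.1 hb with rfl | hb
        · exact ha
        · refine ih _ h.tail ?_ hb
          have := hG.recurrent_tgt ha (h.fwd a (by simp))
          rwa [(List.isChain_cons_cons.1 h.chain).1.1] at this
    · obtain ⟨p₁, t, rfl, hp₁, h1, h2⟩ := ih h.tail
      refine ⟨a :: p₁, t, rfl, ⟨?_, ?_⟩, ?_, h2⟩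
      · exact fun b hb => h.fwd b (by
          rw [← List.cons_append]
          exact List.mem_append_left _ hb)
      · have := h.chain
        rw [← List.cons_append] at this
        exact this.left_of_append
      · intro b hb
        rcases List.mem_cons.1 hb with rfl | hb
        · exact ha
        · exact h1 b hb

theorem abs_revDeg_le (a : Arrow E) : |G.revDeg a 0| ≤ 1 := by
  have key : ∀ i : ℕ, |(Finsupp.single i 1 : ℕ →₀ ℤ) 0| ≤ 1 := by
    intro i
    rw [Finsupp.single_apply]
    split_ifs <;> simp
  cases a <;> simp only [revDeg] <;> split_ifs <;>
    first
      | exact key _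
      | (rw [Finsupp.neg_apply, abs_neg]; exact key _)

theorem abs_wordDeg_le (l : List (Arrow E)) : |wordDeg G.revDeg l 0| ≤ l.length := by
  induction l with
  | nil => simp
  | cons a l ih =>
    rw [wordDeg_cons, Finsupp.add_apply, List.length_cons, Nat.cast_add, Nat.cast_one, add_comm]
    exact (abs_add_le _ _).trans (add_le_add ih (abs_revDeg_le a))

theorem LocallyFinite.wordDeg_of_recurrent (hG : G.LocallyFinite K) {t : List (Arrow E)}
    (ht : ∀ a ∈ t, G.Recurrent (G.src a) ∧ G.IsFwd a) : wordDeg G.revDeg t 0 = t.length := by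
  induction t with
  | nil => simp
  | cons a t ih =>
    have ha := ht a (by simp)
    rw [wordDeg_cons, Finsupp.add_apply, ih fun b hb => ht b (List.mem_cons_of_mem _ hb),
      hG.revDeg_of_recurrent ha.1 ha.2, Finsupp.single_eq_same, List.length_cons]
    push_cast
    ring

theorem IsFwdPath.length_le [Finite V] {p : List (Arrow E)} (h : G.IsFwdPath p)
    (hp : ∀ a ∈ p, ¬G.Recurrent (G.src a)) : p.length ≤ Nat.card V := by
  have := Fintype.ofFinite V
  rw [Nat.card_eq_fintype_card, ← List.length_map (f := G.src) (as := p)]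
  exact (h.nodup hp).length_le_card

/-- If the paths `p` and `q` do not both end on a cycle, then the degree of `p q^*` bounds their
lengths. -/
theorem LocallyFinite.length_le [Finite V] (hG : G.LocallyFinite K) {p q : List (Arrow E)}
    (hp : G.IsFwdPath p) (hq : G.IsFwdPath q)
    (hpq : ∀ a ∈ p.getLast?, ∀ b ∈ q.getLast?, G.Recurrent (G.src a) → ¬G.Recurrent (G.src b)) :
    p.length + q.length ≤
      4 * Nat.card V + (wordDeg G.revDeg p 0 - wordDeg G.revDeg q 0).natAbs := by
  obtain ⟨p₁, t, rfl, hp₁, hn, ht⟩ := hG.exists_append hp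
  obtain ⟨q₁, t', rfl, hq₁, hn', ht'⟩ := hG.exists_append hq
  have htt : t = [] ∨ t' = [] := by
    by_contra! h
    obtain ⟨a, ha⟩ := List.getLast?_isSome.2 h.1 |> Option.isSome_iff_exists.1
    obtain ⟨b, hb⟩ := List.getLast?_isSome.2 h.2 |> Option.isSome_iff_exists.1
    exact hpq a (by rw [List.getLast?_append, ha]; rfl) b (by rw [List.getLast?_append, hb]; rfl)
      (ht a (List.mem_of_getLast? ha)).1 (ht' b (List.mem_of_getLast? hb)).1
  have h1 := hp₁.length_le hn
  have h2 := hq₁.length_le hn'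
  have h3 := abs_le.1 (abs_wordDeg_le (G := G) p₁)
  have h4 := abs_le.1 (abs_wordDeg_le (G := G) q₁)
  rw [wordDeg_append, wordDeg_append, Finsupp.add_apply, Finsupp.add_apply,
    hG.wordDeg_of_recurrent ht, hG.wordDeg_of_recurrent ht', List.length_append,
    List.length_append]
  rcases htt with rfl | rfl
  · simp only [List.length_nil]
    omega
  · simp only [List.length_nil]
    omega

theorem isChain_of_word_ne_zero {l : List (Arrow E)} {y : V} (h : G.word K l y ≠ 0) :
    l.IsChain fun a b => G.val K a * G.val K b ≠ 0 := by
  induction l with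
  | nil => simp
  | cons a l ih =>
    cases l with
    | nil => simp
    | cons b l =>
      refine List.isChain_cons_cons.2 ⟨fun hab => h ?_, ih fun h0 => h ?_⟩
      · rw [word, word, ← mul_assoc, hab, zero_mul]
      · rw [word, h0, mul_zero]

theorem starRev_starRev (l : List (Arrow E)) : starRev (starRev l) = l := by
  have h : (Arrow.star ∘ Arrow.star : Arrow E → Arrow E) = id := funext Arrow.star_star
  simp [starRev, h]

theorem LocallyFinite.isFwdPath_of_word_ne_zero (hG : G.LocallyFinite K)
    {p q : List (Arrow E)} {y : V} (hp : ∀ a ∈ p, G.IsFwd a) (hq : ∀ a ∈ q, G.IsFwd a)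
    (h : G.word K (p ++ starRev q) y ≠ 0) : G.IsFwdPath p ∧ G.IsFwdPath q := by
  have hc := isChain_of_word_ne_zero h
  refine ⟨⟨hp, ?_⟩, ⟨hq, ?_⟩⟩
  · refine List.IsChain.imp_of_mem_imp (fun a b ha hb hab => ⟨?_, fun ht => ?_⟩)
      hc.left_of_append
    · by_contra hne
      exact hab (val_mul_val_of_ne hne)
    · exact hab (hG.term_mul_fwd ht (hp b hb))
  · have hc' := hc.right_of_append
    rw [starRev, List.isChain_reverse, List.isChain_map] at hc'
    refine List.IsChain.imp_of_mem_imp (fun a b ha hb hab => ⟨?_, fun ht => ?_⟩) hc'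
    · by_contra hne
      refine hab (val_mul_val_of_ne fun h' => hne ?_)
      cases a <;> cases b <;> exact h'.symm
    · exact hab (hG.star_fwd_mul_star_term ht (hq b hb))

theorem word_append_congr {l l' : List (Arrow E)} {y y' : V} (h : G.word K l y = G.word K l' y')
    (p : List (Arrow E)) : G.word K (p ++ l) y = G.word K (p ++ l') y' := by
  induction p with
  | nil => exact h
  | cons a p ih => rw [List.cons_append, List.cons_append, word, word, ih]

theorem word_append_eq_zero {l : List (Arrow E)} {y : V} (h : G.word K l y = 0)
    (p : List (Arrow E)) : G.word K (p ++ l) y = 0 := by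
  induction p with
  | nil => exact h
  | cons a p ih => rw [List.cons_append, word, ih, mul_zero]

variable (G K) in
/-- The images of the words of length at most `n`. -/
def shortWords (n : ℕ) : Set (G.WLPA K) :=
  {x | ∃ l y, (∀ a ∈ l, G.Valid a) ∧ l.length ≤ n ∧ x = G.word K l y}

/-- Cancelling `a a^*` for arrows `a` on cycles shows that bounded words suffice to span a
component. -/
theorem LocallyFinite.word_mem_span_shortWords [Finite V] (hG : G.LocallyFinite K)
    (g : ℕ →₀ ℤ) (p : List (Arrow E)) : ∀ (q : List (Arrow E)) (y : V), (∀ a ∈ p, G.IsFwd a) →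
      (∀ a ∈ q, G.IsFwd a) → wordDeg G.revDeg p - wordDeg G.revDeg q = g →
      G.word K (p ++ starRev q) y ∈
        Submodule.span K (G.shortWords K (4 * Nat.card V + (g 0).natAbs)) := by
  induction p using List.reverseRecOn with
  | nil =>
    intro q y hp hq hg
    by_cases h0 : G.word K ([] ++ starRev q) y = 0
    · rw [h0]; exact zero_mem _
    obtain ⟨hp', hq'⟩ := hG.isFwdPath_of_word_ne_zero hp hq h0
    have hlen := hG.length_le hp' hq' (by simp)
    rw [← Finsupp.sub_apply, hg] at hlen
    refine Submodule.subset_span ⟨_, y, ?_, ?_, rfl⟩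
    · intro a ha
      simp only [starRev, List.nil_append, List.mem_reverse, List.mem_map] at ha
      obtain ⟨b, hb, rfl⟩ := ha
      exact (hq b hb).valid.star
    · simpa [starRev] using hlen
  | append_singleton p a ih =>
    intro q y hp hq hg
    by_cases h0 : G.word K (p ++ [a] ++ starRev q) y = 0
    · rw [h0]; exact zero_mem _
    obtain ⟨hp', hq'⟩ := hG.isFwdPath_of_word_ne_zero hp hq h0
    by_cases hpq : ∀ a' ∈ (p ++ [a]).getLast?, ∀ b ∈ q.getLast?,
      G.Recurrent (G.src a') → ¬G.Recurrent (G.src b)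
    · have hlen := hG.length_le hp' hq' hpq
      rw [← Finsupp.sub_apply, hg] at hlen
      refine Submodule.subset_span ⟨_, y, ?_, ?_, rfl⟩
      · intro c hc
        rcases List.mem_append.1 hc with hc | hc
        · exact (hp c hc).valid
        · simp only [starRev, List.mem_reverse, List.mem_map] at hc
          obtain ⟨b, hb, rfl⟩ := hc
          exact (hq b hb).valid.star
      · rwa [List.length_append, starRev, List.length_reverse, List.length_map]
    · push Not at hpq
      obtain ⟨a', ha', b, hb, hra, hrb⟩ := hpq
      obtain rfl : a = a' := by simpa using ha'
      obtain ⟨q, rfl⟩ := List.mem_getLast?_eq_getLast hb |> fun ⟨h1, h2⟩ =>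
        (⟨q.dropLast, by rw [h2, List.dropLast_append_getLast]⟩ : ∃ q', q = q' ++ [b])
      have hfa : G.IsFwd a := hp a (by simp)
      have hfb : G.IsFwd b := hq b (by simp)
      have hstar : starRev (q ++ [b]) = b.star :: starRev q := by simp [starRev]
      rw [hstar, List.append_assoc, List.singleton_append] at h0 ⊢
      have hab : a = b := by
        have hc := (isChain_of_word_ne_zero h0).right_of_append
        have hne := (List.isChain_cons_cons.1 hc).1
        refine hG.eq_of_tgt_eq hra hfa hrb hfb ?_
        by_contra h
        refine hne (val_mul_val_of_ne fun h' => h (h'.trans ?_))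
        cases b <;> rfl
      subst hab
      have hW : G.word K (a :: a.star :: starRev q) y =
          G.vtx K (G.src a) * G.word K (starRev q) y := by
        rw [word, word, ← mul_assoc, hG.val_mul_star_of_recurrent hra hfa]
      rcases vtx_mul_word (K := K) (G.src a) (starRev q) y with h | h
      · rw [word_append_congr (hW.trans h)]
        refine ih q y (fun c hc => hp c (by simp [hc])) (fun c hc => hq c (by simp [hc])) ?_
        rw [← hg]
        simp
      · exact absurd (word_append_eq_zero (hW.trans h) p) h0

theorem finite_lists_length_le {α : Type*} {S : Set α} (hS : S.Finite) (n : ℕ) :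
    {l : List α | (∀ a ∈ l, a ∈ S) ∧ l.length ≤ n}.Finite := by
  induction n with
  | zero =>
    refine (Set.finite_singleton []).subset ?_
    rintro l ⟨-, hl⟩
    exact List.length_eq_zero_iff.1 (Nat.le_zero.1 hl)
  | succ n ih =>
    refine ((hS.image2 List.cons ih).union (Set.finite_singleton [])).subset ?_
    rintro l ⟨hl, hn⟩
    cases l with
    | nil => exact .inr rfl
    | cons a l =>
      refine .inl ⟨a, hl a (by simp), l, ⟨fun b hb => hl b (by simp [hb]), ?_⟩, rfl⟩
      simpa using hn

theorem finite_valid [Finite V] : {a | G.Valid a}.Finite := by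
  have : Finite E := by
    refine Set.finite_univ_iff.1 ((Set.finite_iUnion G.rowFinite).subset ?_)
    intro e _
    exact Set.mem_iUnion.2 ⟨G.s e, rfl⟩
  refine ((Set.finite_range fun p : Σ e, Fin (G.w e) => Arrow.real p.1 (p.2 : ℕ)).union
    (Set.finite_range fun p : Σ e, Fin (G.w e) => Arrow.ghost p.1 (p.2 : ℕ))).subset ?_
  rintro (⟨e, i⟩ | ⟨e, i⟩) h
  · exact .inl ⟨⟨e, i, h⟩, rfl⟩
  · exact .inr ⟨⟨e, i, h⟩, rfl⟩

theorem finite_shortWords [Finite V] (n : ℕ) : (G.shortWords K n).Finite := by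
  refine (((finite_lists_length_le (finite_valid (G := G)) n).prod
    (Set.finite_univ (α := V))).image fun p => G.word K p.1 p.2).subset ?_
  rintro x ⟨l, y, hl, hn, rfl⟩
  exact ⟨(l, y), ⟨⟨hl, hn⟩, trivial⟩, rfl⟩

theorem LocallyFinite.finiteDimensional_fwdSpan (hG : G.LocallyFinite K) (g : ℕ →₀ ℤ) :
    FiniteDimensional K (G.fwdSpan K g) := by
  obtain ⟨sp, hsp⟩ := G.exists_isSpecial
  have := hG.finite_vertices hsp
  have hfin := FiniteDimensional.span_of_finite K
    (finite_shortWords (G := G) (K := K) (4 * Nat.card V + (g 0).natAbs))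
  refine Submodule.finiteDimensional_of_le (Submodule.span_le.2 ?_) (S₂ := Submodule.span K
    (G.shortWords K (4 * Nat.card V + (g 0).natAbs)))
  rintro _ ⟨p, m, y, hp, hm, hg, rfl⟩
  rw [← starRev_starRev m] at hg ⊢
  refine hG.word_mem_span_shortWords g p (starRev m) y hp ?_ ?_
  · intro a ha
    simp only [starRev, List.mem_reverse, List.mem_map] at ha
    obtain ⟨b, hb, rfl⟩ := ha
    exact hm b hb
  · rw [wordDeg_append, wordDeg_revDeg_starRev] at hg
    rw [sub_eq_add_neg, hg]

/-- The isomorphism maps each component of the algebra of the reversed graph into the corresponding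
span of words in forward arrows. -/
theorem LocallyFinite.lift_mem_fwdSpan (hG : G.LocallyFinite K) {g : ℕ →₀ ℤ}
    {x : (G.reverse G.revEdges hG.isReversible).WLPA K}
    (hx : x ∈ (G.reverse G.revEdges hG.isReversible).component K g) :
    (hG.isReversible.toFamily K).lift x ∈ G.fwdSpan K g := by
  set H := G.reverse G.revEdges hG.isReversible
  set F := hG.isReversible.toFamily K
  have hletter : ∀ a : H.Letter, (∃ x, F.lift (letterVal a : H.WLPA K) = G.vtx K x ∧
      H.letterDegree a = 0) ∨ ∃ b, F.lift (letterVal a : H.WLPA K) = G.val K b ∧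
        H.letterDegree a = G.revDeg b := by
    rintro (x | ⟨e | ⟨h, j⟩, i⟩ | ⟨e | ⟨h, j⟩, i⟩)
    · exact .inl ⟨x, F.lift_vtx x, rfl⟩
    · exact .inr ⟨.real e i, F.lift_re _ _, (if_neg e.2).symm⟩
    · have hi : (i : ℕ) = 0 := Nat.lt_one_iff.1 i.2
      refine .inr ⟨.ghost h j, (F.lift_re _ _).trans (if_pos hi), ?_⟩
      rw [letterDegree, revDeg, if_pos h.2, hi]
    · exact .inr ⟨.ghost e i, F.lift_gh _ _, (if_neg e.2).symm⟩
    · have hi : (i : ℕ) = 0 := Nat.lt_one_iff.1 i.2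
      refine .inr ⟨.real h j, (F.lift_gh _ _).trans (if_pos hi), ?_⟩
      rw [letterDegree, revDeg, if_pos h.2, hi]
  induction hx using Submodule.span_induction with
  | zero => rw [map_zero]; exact zero_mem _
  | add x y _ _ hx hy => rw [map_add]; exact add_mem hx hy
  | smul c x _ hx => rw [map_smul]; exact Submodule.smul_mem _ c hx
  | mem x hx =>
    obtain ⟨p, rfl, rfl⟩ := hx
    induction p using FreeSemigroup.recOnMul with
    | ih1 a =>
      have hd : H.degree (.of a) = H.letterDegree a := by simp [degree]
      rw [mk_of, hd]
      rcases hletter a with ⟨x, h1, h2⟩ | ⟨b, h1, h2⟩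
      · rw [h1, h2]; exact vtx_mem_fwdSpan x
      · rw [h1, h2]; exact hG.val_mem_fwdSpan b
    | ih2 a p _ ih =>
      have hd : H.degree (.of a * p) = H.letterDegree a + H.degree p := by simp [degree]
      rw [mk_of_mul, map_mul, hd]
      rcases hletter a with ⟨x, h1, h2⟩ | ⟨b, h1, h2⟩
      · rw [h1, h2, zero_add]; exact vtx_mul_mem_fwdSpan x ih
      · rw [h1, h2]; exact hG.val_mul_mem_fwdSpan b ih

/-- Reversing edges preserves local finiteness. -/
theorem LocallyFinite.reverse (hG : G.LocallyFinite K) :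
    (G.reverse G.revEdges hG.isReversible).LocallyFinite K := by
  intro g
  have := hG.finiteDimensional_fwdSpan g
  let Φ : (G.reverse G.revEdges hG.isReversible).WLPA K →ₗ[K] G.WLPA K :=
    ((hG.isReversible.toFamily K).lift (K := K) : _ →ₗ[K] _)
  refine Module.Finite.of_injective
    (Φ.restrict (p := component _ K g) (q := G.fwdSpan K g) fun x hx => hG.lift_mem_fwdSpan hx) ?_
  intro x y hxy
  exact Subtype.ext (hG.isReversible.bijective_lift.1 (congrArg Subtype.val hxy))

end WeightedGraph

open WeightedGraph in
theorem proposition5p2 {V : Type u} {E : Type v} {K : Type k} [Field K]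
    (G : WeightedGraph V E) (hG : G.LocallyFinite K) :
    ∃ (E' : Type v) (G' : WeightedGraph V E') (ι : G.typeB → E'),
      Function.Injective ι ∧
      Set.range ι = G'.weightedEdges ∧
      G'.weightedEdges = G'.typeB ∧
      (∀ e : G.typeB, G'.s (ι e) = G.s e ∧ G'.r (ι e) = G.r e ∧ G'.w (ι e) = G.w e) ∧
      (∀ e ∈ G'.weightedEdges, G'.IsSink (G'.r e)) ∧
      (∃ Φ : G'.WLPA K →ₙₐ[K] G.WLPA K, Function.Bijective Φ) ∧
      G'.LocallyFinite K := by
  set R := G.revEdges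
  have hrange : Set.range (fun e : G.typeB => (.inl ⟨e, notMem_revEdges_of_typeB e.2⟩ :
      G.RevEdge R)) = (G.reverse R hG.isReversible).weightedEdges := by
    ext e
    constructor
    · rintro ⟨e, rfl⟩
      exact e.2.1
    · rcases e with e | p
      · exact fun he => ⟨⟨e, mem_typeB_of_weighted e.2 he⟩, rfl⟩
      · exact fun he => absurd he (lt_irrefl 1)
  refine ⟨G.RevEdge R, G.reverse R hG.isReversible,
    fun e => .inl ⟨e, notMem_revEdges_of_typeB e.2⟩, ?_, hrange, ?_, fun e => ⟨rfl, rfl, rfl⟩, ?_,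
    ⟨_, hG.isReversible.bijective_lift⟩, hG.reverse⟩
  · intro e f hef
    simpa [Subtype.ext_iff] using hef
  · refine Set.Subset.antisymm ?_ fun e he => he.1
    intro e he
    refine ⟨he, fun hsole => ?_⟩
    rw [← hrange] at he
    obtain ⟨e, rfl⟩ := he
    refine e.2.2 (Set.eq_singleton_iff_unique_mem.2 ⟨rfl, fun f hf => ?_⟩)
    have hfR : f ∉ R := hG.isReversible.notMem_of_source_eq (notMem_revEdges_of_typeB e.2) hf
    have hmem : (.inl ⟨f, hfR⟩ : G.RevEdge R) ∈
        ({.inl ⟨e, notMem_revEdges_of_typeB e.2⟩} : Set (G.RevEdge R)) := by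
      rw [← hsole]
      exact hf
    simpa using hmem
  · intro e he
    rw [← hrange] at he
    obtain ⟨e, rfl⟩ := he
    rintro (f | p) hf
    · have hf' : G.s f = G.r e := hf
      exact hG.not_inTail_source f.2 (hf' ▸ inTail_range (mem_tailEdges_of_typeB e.2))
    · have hp := hG.range_injOn p.1.2.1 (mem_tailEdges_of_typeB e.2) hf
      exact notMem_revEdges_of_typeB e.2 (hp ▸ p.1.2)
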